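/- A Steiner triple system on a set of $v$ points (an $STS(v)$) is a set of 3-subsets (blocks) of the point set such that every pair of distinct points lies in exactly one block. It is resolvable if its block set can be partitioned into parallel classes, that is, into sets of blocks covering every point exactly once. Its 3-rank is the rank over $\mathbb{F}_3$ of its block-by-point incidence matrix. A Latin square of order $n$ is an $n\times n$ array on $n$ fixed symbols in which each symbol occurs exactly once in each row and each column; two Latin squares of order $n$ are orthogonal mates if superimposing them yields no ordered pair of symbols twice. Let $k,t$ be integers with $2\le t\le k-1$, and put $T=3^t$, $T'=3^{t-1}$, $M=3^{k-t}$, $M'=3^{k-t+1}$. Let $N_1(n)$ and $\widetilde N_1(n)$ be the number of distinct Steiner triple systems, respectively of distinct resolvable Steiner triple systems, on a fixed set of $n$ points, and let $N_3(n)$ and $\widetilde N_3(n)$ be the number of distinct Latin squares of order $n$ on a fixed set of $n$ symbols, respectively of those having an orthogonal mate. Then the number $(k,t)$ of isomorphism classes of resolvable Steiner triple systems on $3^k$ points with 3-rank exactly $3^k-k-1+t$ satisfies $$(k,t)\;\ge\;\frac{\widetilde N_1(T)^{M}\cdot\widetilde N_3(T)^{M(M-1)/6}}{(T!)^{M}\cdot|AGL(k-t,3)|}\;-\;\frac{N_1(T')^{M'}\cdot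 N_3(T')^{M'(M'-1)/6}}{\big((T')!\big)^{M'-k+t-2}},$$ where $AGL(d,3)$ is the group of affine bijections of $\mathbb{F}_3^d$. -/

import Mathlib

open scoped Nat

namespace STSRank

/-- `B` is the block set of a `t`-`(v, k, lam)` design on the point set `P`, where `v` is the
number of points: every block has `k` points and every `t`-set of points lies in exactly `lam`
blocks. -/
def IsDesign {P : Type*} [DecidableEq P] (t k lam : ℕ) (B : Finset (Finset P)) : Prop :=
  (∀ b ∈ B, b.card = k) ∧
    ∀ s : Finset P, s.card = t → (B.filter fun b => s ⊆ b).card = lam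

/-- `B` is the block set of a Steiner triple system on the point set `P`. -/
def IsSTS {P : Type*} [DecidableEq P] (B : Finset (Finset P)) : Prop :=
  IsDesign 2 3 1 B

/-- `C` is a parallel class of `B`: a set of blocks covering every point exactly once. -/
def IsParallelClass {P : Type*} [DecidableEq P] (B C : Finset (Finset P)) : Prop :=
  C ⊆ B ∧ IsDesign 1 3 1 C

/-- The block set can be partitioned into parallel classes. -/
def IsResolvable {P : Type*} [DecidableEq P] (B : Finset (Finset P)) : Prop :=
  ∃ p : Finpartition B, ∀ C ∈ p.parts, IsParallelClass B C

/-- The block-by-point incidence matrix over the field with three elements. -/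
def incidenceMatrix {P : Type*} [DecidableEq P] (B : Finset (Finset P)) :
    Matrix {b // b ∈ B} P (ZMod 3) :=
  Matrix.of fun b x => if x ∈ b.1 then 1 else 0

/-- The 3-rank of a block set: the rank of its incidence matrix over the field with three
elements. -/
noncomputable def threeRank {P : Type*} [DecidableEq P] [Fintype P]
    (B : Finset (Finset P)) : ℕ :=
  (incidenceMatrix B).rank

/-- Two block sets are isomorphic if some bijection of the points maps the one onto the other. -/
def Isomorphic {P : Type*} [DecidableEq P] (B B' : Finset (Finset P)) : Prop :=
  ∃ e : P ≃ P, B.image (fun b => b.image e) = B'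

theorem Isomorphic.equivalence {P : Type*} [DecidableEq P] :
    Equivalence (Isomorphic (P := P)) where
  refl B := ⟨Equiv.refl P, by simp⟩
  symm := by
    rintro B _ ⟨e, rfl⟩
    exact ⟨e.symm, by simp [Finset.image_image, Function.comp_def]⟩
  trans := by
    rintro B _ _ ⟨e, rfl⟩ ⟨f, rfl⟩
    exact ⟨e.trans f, by simp [Finset.image_image, Function.comp_def]⟩

/-- The resolvable Steiner triple systems with 3-rank exactly `r` on the points of `Fin v`. -/
def ResolvableSTS (v r : ℕ) : Type :=
  {B : Finset (Finset (Fin v)) // IsSTS B ∧ IsResolvable B ∧ threeRank B = r}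

/-- Isomorphism, as an equivalence relation on `ResolvableSTS v r`. -/
def resolvableSTSSetoid (v r : ℕ) : Setoid (ResolvableSTS v r) where
  r S S' := Isomorphic S.1 S'.1
  iseqv := Isomorphic.equivalence.comap Subtype.val

/-- The number of isomorphism classes of resolvable Steiner triple systems on `v` points with
3-rank exactly `r`. -/
noncomputable def numIsoClasses (v r : ℕ) : ℕ :=
  Nat.card (Quotient (resolvableSTSSetoid v r))

/-- The number of distinct Steiner triple systems on a fixed set of `v` points. -/
noncomputable def numSTS (v : ℕ) : ℕ :=
  Nat.card {B : Finset (Finset (Fin v)) // IsSTS B}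

/-- The number of distinct resolvable Steiner triple systems on a fixed set of `v` points. -/
noncomputable def numResolvableSTS (v : ℕ) : ℕ :=
  Nat.card {B : Finset (Finset (Fin v)) // IsSTS B ∧ IsResolvable B}

/-- `L` is a Latin square of order `n` on the symbols `Fin n`: every symbol occurs exactly once
in each row and exactly once in each column. -/
def IsLatinSquare {n : ℕ} (L : Fin n → Fin n → Fin n) : Prop :=
  (∀ i s, ∃! j, L i j = s) ∧ ∀ j s, ∃! i, L i j = s

/-- `L` has an orthogonal mate: a Latin square `L'` such that no two cells carry the same ordered
pair of symbols of `L` and `L'`. -/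
def HasOrthogonalMate {n : ℕ} (L : Fin n → Fin n → Fin n) : Prop :=
  ∃ L' : Fin n → Fin n → Fin n, IsLatinSquare L' ∧
    Function.Injective fun c : Fin n × Fin n => (L c.1 c.2, L' c.1 c.2)

/-- The number of Latin squares of order `n` on the symbols `Fin n`. -/
noncomputable def numLatin (n : ℕ) : ℕ :=
  Nat.card {L : Fin n → Fin n → Fin n // IsLatinSquare L}

/-- The number of Latin squares of order `n` on the symbols `Fin n` with an orthogonal mate. -/
noncomputable def numLatinWithMate (n : ℕ) : ℕ :=
  Nat.card {L : Fin n → Fin n → Fin n // IsLatinSquare L ∧ HasOrthogonalMate L}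

/-- The affine general linear group `AGL(d, 3)`. -/
abbrev AGL3 (d : ℕ) : Type :=
  (Fin d → ZMod 3) ≃ᵃ[ZMod 3] (Fin d → ZMod 3)

end STSRank

namespace STSRank

open Finset

/-! By rank-nullity the 3-rank is the number of points minus the dimension of the dual code, the
functions to the field with three elements that sum to zero over every block. Take `W × Fin T` as
point set, with `W` of dimension `k - t`. The affine functions of the first coordinate form a code
of dimension `k - t + 1`, so a system whose dual code is exactly this code has the prescribed rank.

The dual code contains the affine code precisely when every block lies in one fibre or projects
bijectively onto a line of `W` (`affineCode_le_dualCode_iff`, `isOver_affineLines_iff`). Such a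
system amounts to an independent choice of a triple system on each of the `M` fibres and a Latin
square for each of the `M(M-1)/6` lines. Resolvable fibres and squares with mates glue to a
resolvable system, because the lines of `W` are themselves resolvable (`isResolvable_glue`). This
gives the first numerator.

Systems with a strictly larger dual code must be discarded. An extra dual function `f` makes `(x.1,
f x)` a map onto `W × ZMod 3` with fibres of size `T'`, so the system is also fibred over a space of
one dimension more (`card_lt_dualCode_le`). There are at most `(T! / T'!^3)^M` choices of `f`, and
the fibred systems are counted as before.

An isomorphism between two of the remaining systems preserves the affine code, hence induces an
affine bijection of `W`; each class therefore meets at most `T!^M * |AGL|` of them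
(`card_dualCode_eq_le`). Division yields the bound. -/

/-! ### Steiner triple systems and their resolutions -/

theorem isSTS_iff {P : Type*} [DecidableEq P] {B : Finset (Finset P)} :
    IsSTS B ↔ (∀ b ∈ B, b.card = 3) ∧ ∀ x y, x ≠ y → ∃! b, b ∈ B ∧ x ∈ b ∧ y ∈ b := by
  unfold IsSTS IsDesign
  refine and_congr_right fun _ => ⟨fun h x y hxy => ?_, fun h s hs => ?_⟩
  · have := h {x, y} (card_pair hxy)
    rw [card_eq_one, singleton_iff_unique_mem] at this
    simpa [insert_subset_iff] using this
  · obtain ⟨x, y, hxy, rfl⟩ := card_eq_two.1 hs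
    rw [card_eq_one, singleton_iff_unique_mem]
    simpa [insert_subset_iff] using h x y hxy

theorem isDesign_one_iff {P : Type*} [DecidableEq P] {B : Finset (Finset P)} :
    IsDesign 1 3 1 B ↔ (∀ b ∈ B, b.card = 3) ∧ ∀ x, ∃! b, b ∈ B ∧ x ∈ b := by
  unfold IsDesign
  refine and_congr_right fun _ => ⟨fun h x => ?_, fun h s hs => ?_⟩
  · have := h {x} (card_singleton x)
    rw [card_eq_one, singleton_iff_unique_mem] at this
    simpa using this
  · obtain ⟨x, rfl⟩ := card_eq_one.1 hs
    rw [card_eq_one, singleton_iff_unique_mem]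
    simpa using h x

theorem IsSTS.eq_of_mem {P : Type*} [DecidableEq P] {B : Finset (Finset P)} (h : IsSTS B)
    {x y : P} (hxy : x ≠ y) {b b' : Finset P} (hb : b ∈ B) (hb' : b' ∈ B)
    (hx : x ∈ b) (hy : y ∈ b) (hx' : x ∈ b') (hy' : y ∈ b') : b = b' :=
  ((isSTS_iff.1 h).2 x y hxy).unique ⟨hb, hx, hy⟩ ⟨hb', hx', hy'⟩

/-- `cls` lists the classes of a partition of `B` into sets of blocks that cover every point
exactly once. -/
structure IsResolution {P κ : Type*} (B : Finset (Finset P)) (cls : κ → Finset (Finset P)) :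
    Prop where
  mem_iff : ∀ b, b ∈ B ↔ ∃ c, b ∈ cls c
  existsUnique : ∀ c x, ∃! b, b ∈ cls c ∧ x ∈ b
  eq_of_mem : ∀ c c' b, b ∈ cls c → b ∈ cls c' → c = c'

theorem IsResolution.isResolvable {P κ : Type*} [DecidableEq P] [Nonempty P] [Fintype κ]
    {B : Finset (Finset P)} {cls : κ → Finset (Finset P)} (h : IsResolution B cls)
    (hB : ∀ b ∈ B, b.card = 3) : IsResolvable B := by
  classical
  refine ⟨⟨univ.image cls, ?_, ?_, ?_⟩, ?_⟩
  · rw [supIndep_iff_pairwiseDisjoint]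
    intro C hC C' hC' hne
    obtain ⟨c, -, rfl⟩ := mem_image.1 (mem_coe.1 hC)
    obtain ⟨c', -, rfl⟩ := mem_image.1 (mem_coe.1 hC')
    refine disjoint_left.2 fun b hb hb' => hne ?_
    rw [h.eq_of_mem c c' b hb hb']
  · ext b
    simp [mem_sup, h.mem_iff]
  · intro hbot
    obtain ⟨c, -, hc⟩ := mem_image.1 hbot
    obtain ⟨x⟩ := ‹Nonempty P›
    obtain ⟨b, ⟨hb, -⟩, -⟩ := h.existsUnique c x
    rw [hc] at hb
    simp at hb
  · intro C hC
    obtain ⟨c, -, rfl⟩ := mem_image.1 hC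
    have hsub : cls c ⊆ B := fun b hb => (h.mem_iff b).2 ⟨c, hb⟩
    exact ⟨hsub, isDesign_one_iff.2 ⟨fun b hb => hB b (hsub hb), h.existsUnique c⟩⟩

theorem isResolution_parts {P : Type*} [DecidableEq P] {B : Finset (Finset P)}
    (p : Finpartition B) (hp : ∀ C ∈ p.parts, IsParallelClass B C) :
    IsResolution B fun C : p.parts => C.1 where
  mem_iff _ :=
    ⟨fun hb => (p.exists_mem hb).elim fun C hC => ⟨⟨C, hC.1⟩, hC.2⟩,
      fun ⟨C, hC⟩ => p.subset C.2 hC⟩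
  existsUnique C x := (isDesign_one_iff.1 (hp C.1 C.2).2).2 x
  eq_of_mem C C' _ hb hb' := Subtype.ext (p.eq_of_mem_parts C.2 C'.2 hb hb')

theorem IsResolution.reindex {P κ κ' : Type*} {B : Finset (Finset P)}
    {cls : κ → Finset (Finset P)} (h : IsResolution B cls) (e : κ' ≃ κ) :
    IsResolution B (cls ∘ e) where
  mem_iff b := by rw [h.mem_iff]; exact e.surjective.exists
  existsUnique c x := h.existsUnique (e c) x
  eq_of_mem c c' b hb hb' := e.injective (h.eq_of_mem _ _ b hb hb')

/-- Counting the points other than `x` by the block joining them to `x`. -/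
theorem IsSTS.two_mul_card_filter_mem {P : Type*} [DecidableEq P] [Fintype P]
    {B : Finset (Finset P)} (h : IsSTS B) (x : P) :
    2 * (B.filter (x ∈ ·)).card = Fintype.card P - 1 := by
  have hd : ((B.filter (x ∈ ·)).biUnion fun b => b.erase x) = univ.erase x := by
    ext y
    simp only [mem_biUnion, mem_filter, mem_erase, mem_univ, and_true]
    constructor
    · rintro ⟨b, -, hy, -⟩
      exact hy
    · intro hy
      obtain ⟨b, ⟨hb, hxb, hyb⟩, -⟩ := (isSTS_iff.1 h).2 x y (Ne.symm hy)
      exact ⟨b, ⟨hb, hxb⟩, hy, hyb⟩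
  have hc := congrArg card hd
  rw [card_erase_of_mem (mem_univ x), card_univ, card_biUnion, sum_const_nat (m := 2)] at hc
  · rw [← hc, mul_comm]
  · intro b hb
    rw [mem_filter] at hb
    rw [card_erase_of_mem hb.2, (isSTS_iff.1 h).1 b hb.1]
  · intro b hb b' hb' hne
    rw [mem_coe, mem_filter] at hb hb'
    refine disjoint_left.2 fun y hy hy' => hne ?_
    rw [mem_erase] at hy hy'
    exact h.eq_of_mem (Ne.symm hy.1) hb.1 hb'.1 hb.2 hy.2 hb'.2 hy'.2

theorem IsSTS.six_mul_card {P : Type*} [DecidableEq P] [Fintype P]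
    {B : Finset (Finset P)} (h : IsSTS B) :
    6 * B.card = Fintype.card P * (Fintype.card P - 1) := by
  have h1 : ∑ x : P, (B.filter (x ∈ ·)).card = ∑ b ∈ B, b.card := by
    simp_rw [card_filter]
    rw [sum_comm]
    refine sum_congr rfl fun b _ => ?_
    simp
  rw [sum_const_nat (fun b hb => (isSTS_iff.1 h).1 b hb)] at h1
  have h2 : ∑ x : P, 2 * (B.filter (x ∈ ·)).card = Fintype.card P * (Fintype.card P - 1) := by
    rw [sum_congr rfl fun x _ => h.two_mul_card_filter_mem x]
    simp
  rw [← mul_sum, h1] at h2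
  omega

/-- The blocks through a fixed point meet each parallel class once, so the number of classes is
forced. A common index type lets the classes of different fibres be merged index by index when
gluing. -/
theorem IsResolvable.exists_isResolution {P : Type*} [DecidableEq P] [Fintype P] [Nonempty P]
    {B : Finset (Finset P)} (h : IsResolvable B) (hB : IsSTS B) :
    ∃ cls : Fin ((Fintype.card P - 1) / 2) → Finset (Finset P), IsResolution B cls := by
  obtain ⟨p, hp⟩ := h
  have hr := isResolution_parts p hp
  obtain ⟨x⟩ := ‹Nonempty P›
  have hcard : (B.filter (x ∈ ·)).card = p.parts.card := by
    refine card_bij (fun b _ => p.part b) (fun b hb => ?_) (fun b hb b' hb' he => ?_)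
      fun C hC => ?_
    · exact p.part_mem.2 (mem_filter.1 hb).1
    · rw [mem_filter] at hb hb'
      refine (hr.existsUnique ⟨p.part b, p.part_mem.2 hb.1⟩ x).unique
        ⟨p.mem_part hb.1, hb.2⟩ ⟨?_, hb'.2⟩
      change b' ∈ p.part b
      rw [he]
      exact p.mem_part hb'.1
    · obtain ⟨b, ⟨hb, hx⟩, -⟩ := hr.existsUnique ⟨C, hC⟩ x
      exact ⟨b, mem_filter.2 ⟨(hr.mem_iff b).2 ⟨_, hb⟩, hx⟩, p.part_eq_of_mem hC hb⟩
  have h2 := hB.two_mul_card_filter_mem x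
  have e : Fin ((Fintype.card P - 1) / 2) ≃ p.parts :=
    (finCongr (by omega)).trans p.parts.equivFin.symm
  exact ⟨_, hr.reindex e⟩

/-! ### Transport along bijections of the points -/

/-- The image of a block set under a bijection of the points. -/
def mapBlocks {P Q : Type*} [DecidableEq Q] (e : P ≃ Q)
    (B : Finset (Finset P)) : Finset (Finset Q) :=
  B.image fun b => b.image e

section mapBlocks

variable {P Q : Type*} [DecidableEq Q] (e : P ≃ Q) {B : Finset (Finset P)}

theorem image_equiv_injective : Function.Injective fun b : Finset P => b.image e :=
  image_injective e.injective

theorem mapBlocks_injective : Function.Injective (mapBlocks e) :=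
  image_injective (image_equiv_injective e)

theorem mem_mapBlocks [DecidableEq P] {b : Finset Q} : b ∈ mapBlocks e B ↔ b.image e.symm ∈ B := by
  unfold mapBlocks
  rw [mem_image]
  constructor
  · rintro ⟨b', hb', rfl⟩
    simpa [image_image] using hb'
  · intro hb
    exact ⟨_, hb, by simp [image_image]⟩

theorem existsUnique_mem_mapBlocks [DecidableEq P] {p : Finset Q → Prop} :
    (∃! b, b ∈ mapBlocks e B ∧ p b) ↔ ∃! b, b ∈ B ∧ p (b.image e) := by
  have hbij : Function.Bijective fun b : Finset P => b.image e :=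
    ⟨image_equiv_injective e, fun b => ⟨b.image e.symm, by simp [image_image]⟩⟩
  rw [hbij.existsUnique_iff]
  simp [mem_mapBlocks, image_image]

theorem mem_image_equiv {b : Finset P} {y : Q} : y ∈ b.image e ↔ e.symm y ∈ b := by
  rw [mem_image]
  exact ⟨by rintro ⟨x, hx, rfl⟩; simpa using hx, fun h => ⟨_, h, by simp⟩⟩

theorem IsSTS.mapBlocks [DecidableEq P] (h : IsSTS B) : IsSTS (mapBlocks e B) := by
  rw [isSTS_iff] at h ⊢
  refine ⟨fun b hb => ?_, fun x y hxy => ?_⟩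
  · rw [mem_mapBlocks] at hb
    rw [← h.1 _ hb, card_image_of_injective _ e.symm.injective]
  · rw [existsUnique_mem_mapBlocks]
    simpa only [mem_image_equiv] using h.2 _ _ (e.symm.injective.ne hxy)

theorem IsResolvable.mapBlocks [DecidableEq P] [Nonempty P] (hS : IsSTS B) (h : IsResolvable B) :
    IsResolvable (mapBlocks e B) := by
  obtain ⟨p, hp⟩ := h
  have hr := isResolution_parts p hp
  have := ‹Nonempty P›.map e
  refine IsResolution.isResolvable (cls := fun C : p.parts => STSRank.mapBlocks e C.1)
    ⟨fun b => ?_, fun C x => ?_, fun C C' b hb hb' => ?_⟩ (isSTS_iff.1 (hS.mapBlocks e)).1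
  · simp only [mem_mapBlocks]
    exact hr.mem_iff _
  · rw [existsUnique_mem_mapBlocks]
    simpa only [mem_image_equiv] using hr.existsUnique C (e.symm x)
  · rw [mem_mapBlocks] at hb hb'
    exact hr.eq_of_mem _ _ _ hb hb'

end mapBlocks

/-! ### Latin squares as sets of triples -/

section Latin

variable {n : ℕ}

/-- Rows, columns and symbols play symmetric roles. This form matches the condition that two points
in different fibres over a line lie in one block. -/
theorem IsLatinSquare.existsUnique {L : Fin n → Fin n → Fin n} (h : IsLatinSquare L)
    {p q : Fin 3} (hpq : p ≠ q) (u w : Fin n) :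
    ∃! g : Fin 3 → Fin n, L (g 0) (g 1) = g 2 ∧ g p = u ∧ g q = w := by
  have key : ∀ p q : Fin 3, p < q → ∀ u w : Fin n,
      ∃! g : Fin 3 → Fin n, L (g 0) (g 1) = g 2 ∧ g p = u ∧ g q = w := by
    intro p q hpq u w
    have hcases : (p = 0 ∧ q = 1) ∨ (p = 0 ∧ q = 2) ∨ (p = 1 ∧ q = 2) := by omega
    obtain ⟨rfl, rfl⟩ | ⟨rfl, rfl⟩ | ⟨rfl, rfl⟩ := hcases
    · refine ⟨![u, w, L u w], by simp, ?_⟩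
      rintro g ⟨hg, rfl, rfl⟩
      ext i
      fin_cases i <;> simp [hg]
    · obtain ⟨j, hj, huniq⟩ := h.1 u w
      refine ⟨![u, j, w], by simpa using hj, ?_⟩
      rintro g ⟨hg, rfl, rfl⟩
      have := huniq _ hg
      ext i
      fin_cases i <;> simp [this]
    · obtain ⟨j, hj, huniq⟩ := h.2 u w
      refine ⟨![j, u, w], by simpa using hj, ?_⟩
      rintro g ⟨hg, rfl, rfl⟩
      have := huniq _ hg
      ext i
      fin_cases i <;> simp [this]
  rcases lt_or_gt_of_ne hpq with hlt | hlt
  · exact key p q hlt u w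
  · simpa only [and_comm (a := _ = w)] using key q p hlt w u

/-- The cells where the mate carries a fixed symbol form a transversal. For rows and columns this is
the Latin property of the mate; for symbols it is orthogonality, since an injective map on the
finite set of cells is onto. -/
theorem existsUnique_of_mate {L L' : Fin n → Fin n → Fin n} (h' : IsLatinSquare L')
    (ho : Function.Injective fun c : Fin n × Fin n => (L c.1 c.2, L' c.1 c.2))
    (p : Fin 3) (u m : Fin n) :
    ∃! g : Fin 3 → Fin n, (L (g 0) (g 1) = g 2 ∧ L' (g 0) (g 1) = m) ∧ g p = u := by
  have hcases : p = 0 ∨ p = 1 ∨ p = 2 := by omega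
  obtain rfl | rfl | rfl := hcases
  · obtain ⟨j, hj, huniq⟩ := h'.1 u m
    refine ⟨![u, j, L u j], by simpa using hj, ?_⟩
    rintro g ⟨⟨hg, hm⟩, rfl⟩
    have := huniq _ hm
    ext i
    fin_cases i <;> simp [← this, hg]
  · obtain ⟨j, hj, huniq⟩ := h'.2 u m
    refine ⟨![j, u, L j u], by simpa using hj, ?_⟩
    rintro g ⟨⟨hg, hm⟩, rfl⟩
    have := huniq _ hm
    ext i
    fin_cases i <;> simp [← this, hg]
  · obtain ⟨c, hc⟩ := (Finite.injective_iff_surjective.1 ho) (u, m)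
    have hc1 : L c.1 c.2 = u := congrArg Prod.fst hc
    have hc2 : L' c.1 c.2 = m := congrArg Prod.snd hc
    refine ⟨![c.1, c.2, u], by simp [hc1, hc2], ?_⟩
    rintro g ⟨⟨hg, hm⟩, rfl⟩
    have : (g 0, g 1) = c := ho (by simp [hg, hm, hc1, hc2])
    ext i
    fin_cases i <;> simp [← this]

/-- A set of triples with one member for any two prescribed entries is the graph of a Latin
square. -/
theorem exists_isLatinSquare {O : (Fin 3 → Fin n) → Prop}
    (hO : ∀ p q : Fin 3, p ≠ q → ∀ u w, ∃! g, O g ∧ g p = u ∧ g q = w) :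
    ∃ L : Fin n → Fin n → Fin n, IsLatinSquare L ∧ ∀ g, O g ↔ L (g 0) (g 1) = g 2 := by
  choose G hG huniq using hO 0 1 (by decide)
  have hL : ∀ g, O g ↔ G (g 0) (g 1) 2 = g 2 := by
    intro g
    constructor
    · intro hg
      rw [← huniq (g 0) (g 1) g ⟨hg, rfl, rfl⟩]
    · intro hg
      have : G (g 0) (g 1) = g := by
        have := hG (g 0) (g 1)
        ext i
        fin_cases i
        · simp [this.2.1]
        · simp [this.2.2]
        · simp [hg]
      rw [← this]
      exact (hG _ _).1
  refine ⟨fun i j => G i j 2, ⟨fun i s => ?_, fun j s => ?_⟩, hL⟩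
  · obtain ⟨g, ⟨hg, rfl, rfl⟩, hu⟩ := hO 0 2 (by decide) i s
    refine ⟨g 1, (hL g).1 hg, fun j hj => ?_⟩
    have := hu ![g 0, j, g 2] ⟨(hL _).2 (by simpa using hj), rfl, rfl⟩
    exact congrFun this 1
  · obtain ⟨g, ⟨hg, rfl, rfl⟩, hu⟩ := hO 1 2 (by decide) j s
    refine ⟨g 0, (hL g).1 hg, fun i hi => ?_⟩
    have := hu ![i, g 1, g 2] ⟨(hL _).2 (by simpa using hi), rfl, rfl⟩
    exact congrFun this 0

end Latin

/-! ### Systems fibred over a base triple system -/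

section Blocks

variable {W : Type*} [DecidableEq W] {n : ℕ}

/-- The copy of a set `b` in the fibre over `a`. -/
def fiberBlock (a : W) (b : Finset (Fin n)) : Finset (W × Fin n) :=
  b.image (Prod.mk a)

/-- The triple of points over the line labelled by `e`, with second coordinates `g`. -/
def lineBlock (e : Fin 3 → W) (g : Fin 3 → Fin n) : Finset (W × Fin n) :=
  univ.image fun p => (e p, g p)

theorem mem_fiberBlock {a : W} {b : Finset (Fin n)} {x : W × Fin n} :
    x ∈ fiberBlock a b ↔ a = x.1 ∧ x.2 ∈ b := by
  obtain ⟨c, i⟩ := x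
  simp only [fiberBlock, mem_image, Prod.mk.injEq]
  constructor
  · rintro ⟨j, hj, rfl, rfl⟩
    exact ⟨rfl, hj⟩
  · rintro ⟨rfl, hi⟩
    exact ⟨i, hi, rfl, rfl⟩

theorem mem_lineBlock {e : Fin 3 → W} {g : Fin 3 → Fin n} {x : W × Fin n} :
    x ∈ lineBlock e g ↔ ∃ p, e p = x.1 ∧ g p = x.2 := by
  simp [lineBlock, Prod.ext_iff]

theorem card_fiberBlock (a : W) (b : Finset (Fin n)) : (fiberBlock a b).card = b.card :=
  card_image_of_injective _ (Prod.mk_right_injective a)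

theorem card_lineBlock {e : Fin 3 → W} (he : e.Injective) (g : Fin 3 → Fin n) :
    (lineBlock e g).card = 3 := by
  unfold lineBlock
  rw [card_image_of_injective _ fun p q h => he (congrArg Prod.fst h)]
  rfl

theorem fiberBlock_injective (a : W) :
    Function.Injective (fiberBlock a : Finset (Fin n) → Finset (W × Fin n)) :=
  image_injective (Prod.mk_right_injective a)

theorem lineBlock_injective {e : Fin 3 → W} (he : e.Injective) :
    Function.Injective (lineBlock e : (Fin 3 → Fin n) → Finset (W × Fin n)) := by
  intro g g' h
  funext p
  have : (e p, g p) ∈ lineBlock e g' := h ▸ mem_lineBlock.2 ⟨p, rfl, rfl⟩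
  obtain ⟨q, hq, hq'⟩ := mem_lineBlock.1 this
  exact hq'.symm.trans (congrArg g' (he hq))

theorem fiberBlock_ne_lineBlock {a : W} {b : Finset (Fin n)} {e : Fin 3 → W} (he : e.Injective)
    (g : Fin 3 → Fin n) : fiberBlock a b ≠ lineBlock e g := by
  intro h
  have h0 : (e 0, g 0) ∈ fiberBlock a b := h ▸ mem_lineBlock.2 ⟨0, rfl, rfl⟩
  have h1 : (e 1, g 1) ∈ fiberBlock a b := h ▸ mem_lineBlock.2 ⟨1, rfl, rfl⟩
  have := he ((mem_fiberBlock.1 h0).1.symm.trans (mem_fiberBlock.1 h1).1)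
  exact absurd this (by decide)

/-- `e` labels the points of every block of `A` by the elements of `Fin 3`. -/
def IsLabelling (A : Finset (Finset W)) (e : A → Fin 3 → W) : Prop :=
  ∀ l : A, (e l).Injective ∧ ∀ a, a ∈ l.1 ↔ ∃ p, e l p = a

theorem IsSTS.exists_isLabelling {A : Finset (Finset W)} (hA : IsSTS A) :
    ∃ e : A → Fin 3 → W, IsLabelling A e := by
  refine ⟨fun l p => ((l.1.equivFinOfCardEq ((isSTS_iff.1 hA).1 l.1 l.2)).symm p).1,
    fun l => ⟨?_, fun a => ⟨fun ha => ?_, ?_⟩⟩⟩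
  · exact Subtype.val_injective.comp (Equiv.injective _)
  · exact ⟨l.1.equivFinOfCardEq ((isSTS_iff.1 hA).1 l.1 l.2) ⟨a, ha⟩, by simp⟩
  · rintro ⟨p, rfl⟩
    exact Subtype.property _

/-- Every block of `B` lies in a fibre or over a block of the base. -/
def IsOver {A : Finset (Finset W)} (e : A → Fin 3 → W) (B : Finset (Finset (W × Fin n))) : Prop :=
  ∀ b ∈ B, (∃ a b', b = fiberBlock a b') ∨ ∃ l g, b = lineBlock (e l) g

/-- The blocks of `B` in the fibre over `a`. -/
def fiberBlocks (B : Finset (Finset (W × Fin n))) (a : W) : Finset (Finset (Fin n)) :=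
  univ.filter fun b => fiberBlock a b ∈ B

theorem mem_fiberBlocks {B : Finset (Finset (W × Fin n))} {a : W} {b : Finset (Fin n)} :
    b ∈ fiberBlocks B a ↔ fiberBlock a b ∈ B := by
  simp [fiberBlocks]

variable {A : Finset (Finset W)} {e : A → Fin 3 → W}

theorem IsLabelling.eq_of_lineBlock_eq (he : IsLabelling A e) {l l' : A} {g g' : Fin 3 → Fin n}
    (h : lineBlock (e l) g = lineBlock (e l') g') : l = l' := by
  have key : ∀ (l : A) (g : Fin 3 → Fin n) a, a ∈ l.1 ↔ ∃ i, (a, i) ∈ lineBlock (e l) g := by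
    intro l g a
    rw [(he l).2]
    simp only [mem_lineBlock]
    exact ⟨fun ⟨p, hp⟩ => ⟨_, p, hp, rfl⟩, fun ⟨_, p, hp, _⟩ => ⟨p, hp⟩⟩
  refine Subtype.ext (Finset.ext fun a => ?_)
  rw [key l g, key l' g', h]

theorem exists_fiberBlock_of_mem (he : IsLabelling A e) {b : Finset (W × Fin n)}
    (hb : (∃ a b', b = fiberBlock a b') ∨ ∃ l g, b = lineBlock (e l) g)
    {a : W} {i j : Fin n} (hij : i ≠ j) (hi : (a, i) ∈ b) (hj : (a, j) ∈ b) :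
    ∃ b', b = fiberBlock a b' ∧ i ∈ b' ∧ j ∈ b' := by
  obtain ⟨a', b', rfl⟩ | ⟨l, g, rfl⟩ := hb
  · rw [mem_fiberBlock] at hi hj
    obtain ⟨rfl, hi⟩ := hi
    exact ⟨b', rfl, hi, hj.2⟩
  · rw [mem_lineBlock] at hi hj
    obtain ⟨p, hp, rfl⟩ := hi
    obtain ⟨q, hq, rfl⟩ := hj
    exact absurd (congrArg g ((he l).1 (hp.trans hq.symm))) hij

theorem exists_lineBlock_of_mem (hA : IsSTS A) (he : IsLabelling A e) {b : Finset (W × Fin n)}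
    (hb : (∃ a b', b = fiberBlock a b') ∨ ∃ l g, b = lineBlock (e l) g)
    {l : A} {p q : Fin 3} (hpq : p ≠ q) {u w : Fin n} (hu : (e l p, u) ∈ b)
    (hw : (e l q, w) ∈ b) :
    ∃ g, b = lineBlock (e l) g ∧ g p = u ∧ g q = w := by
  have hne := (he l).1.ne hpq
  obtain ⟨a', b', rfl⟩ | ⟨l', g, rfl⟩ := hb
  · rw [mem_fiberBlock] at hu hw
    exact absurd (hu.1.symm.trans hw.1) hne
  · rw [mem_lineBlock] at hu hw
    obtain ⟨p', hp, rfl⟩ := hu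
    obtain ⟨q', hq, rfl⟩ := hw
    have hl : l' = l := Subtype.ext <| hA.eq_of_mem hne l'.2 l.2 (((he l').2 _).2 ⟨p', hp⟩)
      (((he l').2 _).2 ⟨q', hq⟩) (((he l).2 _).2 ⟨p, rfl⟩) (((he l).2 _).2 ⟨q, rfl⟩)
    subst hl
    exact ⟨g, rfl, congrArg g ((he l').1 hp).symm, congrArg g ((he l').1 hq).symm⟩

/-- A block over a line meets each fibre at most once, so the block joining two points of a fibre
stays in it. -/
theorem IsSTS.fiberBlocks {B : Finset (Finset (W × Fin n))} (hB : IsSTS B)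
    (he : IsLabelling A e) (ho : IsOver e B) (a : W) : IsSTS (fiberBlocks B a) := by
  rw [isSTS_iff] at hB ⊢
  refine ⟨fun b hb => ?_, fun i j hij => ?_⟩
  · rw [mem_fiberBlocks] at hb
    rw [← card_fiberBlock a, hB.1 _ hb]
  · obtain ⟨b, ⟨hb, hi, hj⟩, hu⟩ := hB.2 (a, i) (a, j) (by simpa using hij)
    obtain ⟨b', rfl, hi', hj'⟩ := exists_fiberBlock_of_mem he (ho b hb) hij hi hj
    refine ⟨b', ⟨mem_fiberBlocks.2 hb, hi', hj'⟩, fun c hc => fiberBlock_injective a ?_⟩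
    exact hu _ ⟨mem_fiberBlocks.1 hc.1, mem_fiberBlock.2 ⟨rfl, hc.2.1⟩,
      mem_fiberBlock.2 ⟨rfl, hc.2.2⟩⟩

/-- Two base points determine the base block, so the block joining points of two fibres can only lie
over that one. This is the hypothesis of `exists_isLatinSquare`. -/
theorem IsSTS.existsUnique_lineBlock {B : Finset (Finset (W × Fin n))} (hB : IsSTS B)
    (hA : IsSTS A) (he : IsLabelling A e) (ho : IsOver e B) (l : A) (p q : Fin 3) (hpq : p ≠ q)
    (u w : Fin n) : ∃! g, lineBlock (e l) g ∈ B ∧ g p = u ∧ g q = w := by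
  rw [isSTS_iff] at hB
  obtain ⟨b, ⟨hb, hi, hj⟩, hu⟩ := hB.2 (e l p, u) (e l q, w)
    fun h => (he l).1.ne hpq (congrArg Prod.fst h)
  obtain ⟨g, rfl, hg, hg'⟩ := exists_lineBlock_of_mem hA he (ho b hb) hpq hi hj
  refine ⟨g, ⟨hb, hg, hg'⟩, fun f hf => lineBlock_injective (he l).1 ?_⟩
  exact hu _ ⟨hf.1, mem_lineBlock.2 ⟨p, rfl, hf.2.1⟩, mem_lineBlock.2 ⟨q, rfl, hf.2.2⟩⟩

theorem isSTS_of_isOver {B : Finset (Finset (W × Fin n))} (hA : IsSTS A) (he : IsLabelling A e)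
    (ho : IsOver e B) (hf : ∀ a, IsSTS (fiberBlocks B a))
    (hl : ∀ (l : A) (p q : Fin 3), p ≠ q → ∀ u w,
      ∃! g, lineBlock (e l) g ∈ B ∧ g p = u ∧ g q = w) : IsSTS B := by
  rw [isSTS_iff]
  constructor
  · intro b hb
    obtain ⟨a, b', rfl⟩ | ⟨l, g, rfl⟩ := ho b hb
    · rw [card_fiberBlock]
      exact (isSTS_iff.1 (hf a)).1 b' (mem_fiberBlocks.2 hb)
    · exact card_lineBlock (he l).1 g
  · rintro ⟨a, i⟩ ⟨a', j⟩ hne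
    by_cases haa : a = a'
    · subst haa
      have hij : i ≠ j := fun h => hne (by rw [h])
      obtain ⟨b, ⟨hb, hi, hj⟩, hu⟩ := (isSTS_iff.1 (hf a)).2 i j hij
      refine ⟨fiberBlock a b, ⟨mem_fiberBlocks.1 hb, mem_fiberBlock.2 ⟨rfl, hi⟩,
        mem_fiberBlock.2 ⟨rfl, hj⟩⟩, ?_⟩
      rintro c ⟨hc, hci, hcj⟩
      obtain ⟨c', rfl, hi', hj'⟩ := exists_fiberBlock_of_mem he (ho c hc) hij hci hcj
      rw [hu c' ⟨mem_fiberBlocks.2 hc, hi', hj'⟩]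
    · obtain ⟨l, ⟨hlA, hal, hal'⟩, -⟩ := (isSTS_iff.1 hA).2 a a' haa
      obtain ⟨p, rfl⟩ := ((he ⟨l, hlA⟩).2 a).1 hal
      obtain ⟨q, rfl⟩ := ((he ⟨l, hlA⟩).2 a').1 hal'
      have hpq : p ≠ q := fun h => haa (by rw [h])
      obtain ⟨g, ⟨hg, hgp, hgq⟩, hu⟩ := hl ⟨l, hlA⟩ p q hpq i j
      refine ⟨lineBlock (e ⟨l, hlA⟩) g, ⟨hg, mem_lineBlock.2 ⟨p, rfl, hgp⟩,
        mem_lineBlock.2 ⟨q, rfl, hgq⟩⟩, ?_⟩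
      rintro c ⟨hc, hci, hcj⟩
      obtain ⟨f, rfl, hf, hf'⟩ := exists_lineBlock_of_mem hA he (ho c hc) hpq hci hcj
      rw [hu f ⟨hc, hf, hf'⟩]

end Blocks

/-! ### Decomposing and gluing fibred systems -/

section Count

variable {W : Type*} [DecidableEq W] [Fintype W] {n : ℕ} {A : Finset (Finset W)}
  {e : A → Fin 3 → W}

/-- Steiner triple systems over `A` are determined by their fibres and their Latin squares. -/
theorem card_isOver_le (hA : IsSTS A) (he : IsLabelling A e) :
    Nat.card {B : Finset (Finset (W × Fin n)) // IsSTS B ∧ IsOver e B} ≤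
      numSTS n ^ Fintype.card W * numLatin n ^ A.card := by
  choose L hL hLmem using fun (B : {B : Finset (Finset (W × Fin n)) // IsSTS B ∧ IsOver e B})
    (l : A) => exists_isLatinSquare (B.2.1.existsUnique_lineBlock hA he B.2.2 l)
  let F : {B : Finset (Finset (W × Fin n)) // IsSTS B ∧ IsOver e B} →
      (W → {S : Finset (Finset (Fin n)) // IsSTS S}) ×
        (A → {L : Fin n → Fin n → Fin n // IsLatinSquare L}) := fun B =>
    (fun a => ⟨fiberBlocks B.1 a, B.2.1.fiberBlocks he B.2.2 a⟩, fun l => ⟨L B l, hL B l⟩)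
  have hF : Function.Injective F := by
    intro B B' h
    have h1 : ∀ a b, fiberBlock a b ∈ B.1 ↔ fiberBlock a b ∈ B'.1 := by
      intro a b
      rw [← mem_fiberBlocks, ← mem_fiberBlocks]
      have : fiberBlocks B.1 a = fiberBlocks B'.1 a :=
        congrArg Subtype.val (congrFun (congrArg Prod.fst h) a)
      rw [this]
    have h2 : ∀ l g, lineBlock (e l) g ∈ B.1 ↔ lineBlock (e l) g ∈ B'.1 := by
      intro l g
      have : L B l = L B' l := congrArg Subtype.val (congrFun (congrArg Prod.snd h) l)
      rw [hLmem, hLmem, this]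
    refine Subtype.ext (Finset.ext fun b => ⟨fun hb => ?_, fun hb => ?_⟩)
    · obtain ⟨a, b', rfl⟩ | ⟨l, g, rfl⟩ := B.2.2 b hb
      exacts [(h1 _ _).1 hb, (h2 _ _).1 hb]
    · obtain ⟨a, b', rfl⟩ | ⟨l, g, rfl⟩ := B'.2.2 b hb
      exacts [(h1 _ _).2 hb, (h2 _ _).2 hb]
  refine (Nat.card_le_card_of_injective F hF).trans_eq ?_
  rw [Nat.card_prod, Nat.card_fun, Nat.card_fun, Nat.card_eq_fintype_card (α := W),
    Nat.card_eq_fintype_card (α := A), Fintype.card_coe]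
  rfl

open Classical in
/-- The block set with fibres `S` and with the triples given by the squares `L`. -/
noncomputable def glue (e : A → Fin 3 → W) (S : W → Finset (Finset (Fin n)))
    (L : A → Fin n → Fin n → Fin n) : Finset (Finset (W × Fin n)) :=
  univ.filter fun b => (∃ a, ∃ b' ∈ S a, b = fiberBlock a b') ∨
    ∃ l g, L l (g 0) (g 1) = g 2 ∧ b = lineBlock (e l) g

variable {S : W → Finset (Finset (Fin n))} {L : A → Fin n → Fin n → Fin n}

theorem isOver_glue : IsOver e (glue e S L) := by
  intro b hb
  rw [glue, mem_filter] at hb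
  obtain ⟨a, b', -, rfl⟩ | ⟨l, g, -, rfl⟩ := hb.2
  exacts [Or.inl ⟨_, _, rfl⟩, Or.inr ⟨_, _, rfl⟩]

theorem fiberBlock_mem_glue (he : IsLabelling A e) (hS : ∀ a, IsSTS (S a)) {a : W}
    {b : Finset (Fin n)} : fiberBlock a b ∈ glue e S L ↔ b ∈ S a := by
  rw [glue, mem_filter]
  refine ⟨?_, fun hb => ⟨mem_univ _, Or.inl ⟨a, b, hb, rfl⟩⟩⟩
  rintro ⟨-, ⟨a', b', hb', heq⟩ | ⟨l, g, -, heq⟩⟩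
  · have hc := (isSTS_iff.1 (hS a')).1 b' hb'
    -- A point of the block identifies its fibre; an empty block would not, which is why the block
    -- size is used.
    obtain ⟨i, hi⟩ := card_pos.1 (by omega : 0 < b'.card)
    have hmem : (a', i) ∈ fiberBlock a b := heq ▸ mem_fiberBlock.2 ⟨rfl, hi⟩
    obtain rfl : a = a' := (mem_fiberBlock.1 hmem).1
    rwa [fiberBlock_injective a heq]
  · exact absurd heq (fiberBlock_ne_lineBlock (he l).1 g)

theorem lineBlock_mem_glue (he : IsLabelling A e) {l : A} {g : Fin 3 → Fin n} :
    lineBlock (e l) g ∈ glue e S L ↔ L l (g 0) (g 1) = g 2 := by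
  rw [glue, mem_filter]
  refine ⟨?_, fun hg => ⟨mem_univ _, Or.inr ⟨l, g, hg, rfl⟩⟩⟩
  rintro ⟨-, ⟨a', b', -, heq⟩ | ⟨l', g', hg', heq⟩⟩
  · exact absurd heq.symm (fiberBlock_ne_lineBlock (he l).1 g)
  · obtain rfl := he.eq_of_lineBlock_eq heq
    rwa [lineBlock_injective (he l).1 heq]

theorem isSTS_glue (hA : IsSTS A) (he : IsLabelling A e) (hS : ∀ a, IsSTS (S a))
    (hL : ∀ l, IsLatinSquare (L l)) : IsSTS (glue e S L) := by
  refine isSTS_of_isOver hA he isOver_glue (fun a => ?_) fun l p q hpq u w => ?_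
  · have : fiberBlocks (glue e S L) a = S a :=
      Finset.ext fun b => mem_fiberBlocks.trans (fiberBlock_mem_glue he hS)
    rw [this]
    exact hS a
  · simp only [lineBlock_mem_glue he]
    exact (hL l).existsUnique hpq u w

/-- There are two kinds of parallel class. One takes the class of a given index in every fibre at
once. The other takes a parallel class of the base and a mate symbol `m`, and over each base block
of that class uses the transversal of cells where the mate equals `m`. -/
theorem isResolvable_glue [Nonempty W] [NeZero n] (hA : IsSTS A) (hAr : IsResolvable A)
    (he : IsLabelling A e) (hS : ∀ a, IsSTS (S a)) (hSr : ∀ a, IsResolvable (S a))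
    (hL : ∀ l, IsLatinSquare (L l)) (hLo : ∀ l, HasOrthogonalMate (L l)) :
    IsResolvable (glue e S L) := by
  classical
  choose cS hcS using fun a => (hSr a).exists_isResolution (hS a)
  obtain ⟨cA, hcA⟩ := hAr.exists_isResolution hA
  choose L' hL' hLL' using hLo
  let cls : Fin ((Fintype.card (Fin n) - 1) / 2) ⊕ (Fin ((Fintype.card W - 1) / 2) × Fin n) →
      Finset (Finset (W × Fin n)) := Sum.elim
    (fun c => univ.filter fun b => ∃ a, ∃ b' ∈ cS a c, b = fiberBlock a b')
    (fun c => univ.filter fun b => ∃ l : A, l.1 ∈ cA c.1 ∧ ∃ g,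
      (L l (g 0) (g 1) = g 2 ∧ L' l (g 0) (g 1) = c.2) ∧ b = lineBlock (e l) g)
  have hinl : ∀ c b, b ∈ cls (Sum.inl c) ↔ ∃ a, ∃ b' ∈ cS a c, b = fiberBlock a b' :=
    fun c b => by simp [cls]
  have hinr : ∀ c b, b ∈ cls (Sum.inr c) ↔ ∃ l : A, l.1 ∈ cA c.1 ∧ ∃ g,
      (L l (g 0) (g 1) = g 2 ∧ L' l (g 0) (g 1) = c.2) ∧ b = lineBlock (e l) g :=
    fun c b => by simp [cls]
  refine IsResolution.isResolvable (cls := cls) ⟨fun b => ?_, ?_, ?_⟩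
    (isSTS_iff.1 (isSTS_glue hA he hS hL)).1
  · constructor
    · intro hb
      obtain ⟨a, b', rfl⟩ | ⟨l, g, rfl⟩ := isOver_glue b hb
      · rw [fiberBlock_mem_glue he hS] at hb
        obtain ⟨c, hc⟩ := ((hcS a).mem_iff b').1 hb
        exact ⟨Sum.inl c, (hinl _ _).2 ⟨a, b', hc, rfl⟩⟩
      · rw [lineBlock_mem_glue he] at hb
        obtain ⟨c, hc⟩ := (hcA.mem_iff l.1).1 l.2
        exact ⟨Sum.inr (c, L' l (g 0) (g 1)), (hinr _ _).2 ⟨l, hc, g, ⟨hb, rfl⟩, rfl⟩⟩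
    · rintro ⟨c | c, hc⟩
      · obtain ⟨a, b', hb', rfl⟩ := (hinl _ _).1 hc
        rw [fiberBlock_mem_glue he hS]
        exact ((hcS a).mem_iff b').2 ⟨c, hb'⟩
      · obtain ⟨l, hl, g, hg, rfl⟩ := (hinr _ _).1 hc
        exact (lineBlock_mem_glue he).2 hg.1
  · rintro (c | ⟨c, m⟩) ⟨a, i⟩
    · obtain ⟨b', ⟨hb', hi⟩, hu⟩ := (hcS a).existsUnique c i
      refine ⟨fiberBlock a b', ⟨(hinl _ _).2 ⟨a, b', hb', rfl⟩, mem_fiberBlock.2 ⟨rfl, hi⟩⟩, ?_⟩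
      rintro d ⟨hd, hid⟩
      obtain ⟨a', d', hd', rfl⟩ := (hinl _ _).1 hd
      obtain ⟨rfl, hid⟩ := mem_fiberBlock.1 hid
      rw [hu d' ⟨hd', hid⟩]
    · obtain ⟨l, ⟨hl, hal⟩, hlu⟩ := hcA.existsUnique c a
      have hlA := (hcA.mem_iff l).2 ⟨c, hl⟩
      obtain ⟨p, rfl⟩ := ((he ⟨l, hlA⟩).2 a).1 hal
      obtain ⟨g, ⟨hg, hgp⟩, hgu⟩ :=
        existsUnique_of_mate (hL' _) (hLL' _) p i m
      refine ⟨lineBlock (e ⟨l, hlA⟩) g, ⟨(hinr _ _).2 ⟨⟨l, hlA⟩, hl, g, hg, rfl⟩,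
        mem_lineBlock.2 ⟨p, rfl, hgp⟩⟩, ?_⟩
      rintro d ⟨hd, hid⟩
      obtain ⟨l', hl', f, hf, rfl⟩ := (hinr _ _).1 hd
      obtain ⟨q, hq, hfq⟩ := mem_lineBlock.1 hid
      have hll : l' = ⟨l, hlA⟩ := Subtype.ext (hlu l'.1 ⟨hl', ((he l').2 _).2 ⟨q, hq⟩⟩)
      subst hll
      obtain rfl := (he _).1 hq
      rw [hgu f ⟨hf, hfq⟩]
  · rintro (c | ⟨c, m⟩) (c' | ⟨c', m'⟩) b hb hb'
    · obtain ⟨a, d, hd, rfl⟩ := (hinl _ _).1 hb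
      obtain ⟨a', d', hd', heq⟩ := (hinl _ _).1 hb'
      have hc := (isSTS_iff.1 (hS a)).1 d (((hcS a).mem_iff d).2 ⟨c, hd⟩)
      obtain ⟨i, hi⟩ := card_pos.1 (by omega : 0 < d.card)
      have hmem : (a, i) ∈ fiberBlock a' d' := heq ▸ mem_fiberBlock.2 ⟨rfl, hi⟩
      obtain rfl : a' = a := (mem_fiberBlock.1 hmem).1
      rw [← fiberBlock_injective a' heq] at hd'
      rw [(hcS a').eq_of_mem c c' d hd hd']
    · obtain ⟨a, d, hd, rfl⟩ := (hinl _ _).1 hb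
      obtain ⟨l, -, g, -, heq⟩ := (hinr _ _).1 hb'
      exact absurd heq (fiberBlock_ne_lineBlock (he l).1 g)
    · obtain ⟨a, d, hd, rfl⟩ := (hinl _ _).1 hb'
      obtain ⟨l, -, g, -, heq⟩ := (hinr _ _).1 hb
      exact absurd heq (fiberBlock_ne_lineBlock (he l).1 g)
    · obtain ⟨l, hl, g, hg, rfl⟩ := (hinr _ _).1 hb
      obtain ⟨l', hl', g', hg', heq⟩ := (hinr _ _).1 hb'
      obtain rfl := he.eq_of_lineBlock_eq heq
      obtain rfl := lineBlock_injective (he l).1 heq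
      obtain rfl : m = m' := hg.2.symm.trans hg'.2
      rw [hcA.eq_of_mem c c' l.1 hl hl']

theorem le_card_isOver [Nonempty W] [NeZero n] (hA : IsSTS A) (hAr : IsResolvable A)
    (he : IsLabelling A e) :
    numResolvableSTS n ^ Fintype.card W * numLatinWithMate n ^ A.card ≤
      Nat.card {B : Finset (Finset (W × Fin n)) //
        (IsSTS B ∧ IsResolvable B) ∧ IsOver e B} := by
  let F : (W → {S : Finset (Finset (Fin n)) // IsSTS S ∧ IsResolvable S}) ×
      (A → {L : Fin n → Fin n → Fin n // IsLatinSquare L ∧ HasOrthogonalMate L}) →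
      {B : Finset (Finset (W × Fin n)) // (IsSTS B ∧ IsResolvable B) ∧ IsOver e B} := fun s =>
    ⟨glue e (fun a => (s.1 a).1) fun l => (s.2 l).1,
      ⟨isSTS_glue hA he (fun a => (s.1 a).2.1) fun l => (s.2 l).2.1,
        isResolvable_glue hA hAr he (fun a => (s.1 a).2.1) (fun a => (s.1 a).2.2)
          (fun l => (s.2 l).2.1) fun l => (s.2 l).2.2⟩, isOver_glue⟩
  have hF : Function.Injective F := by
    rintro ⟨S, L⟩ ⟨S', L'⟩ h
    have h' := congrArg Subtype.val h
    change glue e _ _ = glue e _ _ at h'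
    refine Prod.ext (funext fun a => Subtype.ext (Finset.ext fun b => ?_))
      (funext fun l => Subtype.ext (funext fun i => funext fun j => ?_))
    · rw [← fiberBlock_mem_glue (L := fun l => (L l).1) he fun a => (S a).2.1, h',
        fiberBlock_mem_glue he fun a => (S' a).2.1]
    -- The block of the triple `(i, j, L i j)` lies in both glued systems, so the squares agree at
    -- this cell.
    · have := lineBlock_mem_glue (S := fun a => (S a).1) (L := fun l => (L l).1) he (l := l)
        (g := ![i, j, (L l).1 i j])
      rw [h', lineBlock_mem_glue he] at this
      exact (this.2 rfl).symm
  refine Eq.trans_le ?_ (Nat.card_le_card_of_injective F hF)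
  rw [Nat.card_prod, Nat.card_fun, Nat.card_fun, Nat.card_eq_fintype_card (α := W),
    Nat.card_eq_fintype_card (α := A), Fintype.card_coe]
  rfl

end Count

theorem exists_eq_insert_of_card_eq_three {α : Type*} [DecidableEq α] {s : Finset α}
    (hs : s.card = 3) {x y : α} (hx : x ∈ s) (hy : y ∈ s) (hxy : x ≠ y) :
    ∃ z, x ≠ z ∧ y ≠ z ∧ s = {x, y, z} := by
  have h1 : ((s.erase x).erase y).card = 1 := by
    rw [card_erase_of_mem (mem_erase.2 ⟨hxy.symm, hy⟩), card_erase_of_mem hx, hs]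
  obtain ⟨z, hz⟩ := card_eq_one.1 h1
  have hzmem : z ∈ (s.erase x).erase y := hz ▸ mem_singleton_self z
  simp only [mem_erase] at hzmem
  refine ⟨z, hzmem.2.1.symm, hzmem.1.symm, ?_⟩
  rw [← insert_erase hx, ← insert_erase (mem_erase.2 ⟨hxy.symm, hy⟩), hz]

/-! ### The triple system of affine lines and its parallelism -/

section Lines

/-- The lines of the affine space `W` over the field with three elements. -/
def affineLines (W : Type*) [AddCommGroup W] [Fintype W] [DecidableEq W] : Finset (Finset W) :=
  univ.filter fun s => s.card = 3 ∧ ∑ x ∈ s, x = 0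

variable {W : Type*} [AddCommGroup W] [DecidableEq W]

theorem mem_affineLines [Fintype W] {s : Finset W} :
    s ∈ affineLines W ↔ s.card = 3 ∧ ∑ x ∈ s, x = 0 := by
  simp [affineLines]

/-- The set of differences of `s`. For a line this is its direction. -/
def differences (s : Finset W) : Finset W :=
  image₂ (fun x y => x - y) s s

theorem differences_image_add (s : Finset W) (v : W) :
    differences (s.image (v + ·)) = differences s := by
  unfold differences
  rw [image₂_image_left, image₂_image_right]
  simp

theorem eq_insert_of_mem_affineLines [Fintype W] {s : Finset W} (hs : s ∈ affineLines W) {x y : W}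
    (hxy : x ≠ y) (hx : x ∈ s) (hy : y ∈ s) : s = {x, y, -x - y} := by
  rw [mem_affineLines] at hs
  obtain ⟨z, hxz, hyz, rfl⟩ := exists_eq_insert_of_card_eq_three hs.1 hx hy hxy
  have h := hs.2
  rw [sum_insert (by simp [hxy, hxz]), sum_pair hyz] at h
  have : z = -x - y := by
    rw [← add_assoc] at h
    rw [← neg_add', eq_neg_of_add_eq_zero_right h]
  rw [← this]

end Lines

section Affine

variable {W : Type*} [AddCommGroup W] [Module (ZMod 3) W]

theorem add_add_self_eq_zero (x : W) : x + x + x = 0 := by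
  have h : ((1 + 1 + 1 : ZMod 3)) • x = x + x + x := by simp only [add_smul, one_smul]
  rw [← h, show (1 + 1 + 1 : ZMod 3) = 0 by decide, zero_smul]

/-- In characteristic 3 the third-point operation `-x - y` is idempotent, which lets the degenerate
case `x = y` be treated like a line. -/
theorem neg_sub_self (x : W) : -x - x = x := by
  have h := add_add_self_eq_zero x
  rw [add_assoc, add_comm] at h
  rw [sub_eq_add_neg, ← neg_add, neg_eq_of_add_eq_zero_right h]

theorem neg_sub_ne_left {x y : W} (hxy : x ≠ y) : -x - y ≠ x := by
  intro h
  refine hxy ?_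
  have : y = -x - x := by rw [sub_eq_iff_eq_add] at h; rw [h]; abel
  rw [this, neg_sub_self]

theorem neg_sub_ne_right {x y : W} (hxy : x ≠ y) : -x - y ≠ y := by
  rw [neg_sub_left, add_comm, ← neg_sub_left]
  exact neg_sub_ne_left hxy.symm

variable [Fintype W] [DecidableEq W]

theorem insert_mem_affineLines {x y : W} (hxy : x ≠ y) : {x, y, -x - y} ∈ affineLines W := by
  rw [mem_affineLines, card_eq_three]
  refine ⟨⟨x, y, _, hxy, (neg_sub_ne_left hxy).symm, (neg_sub_ne_right hxy).symm, rfl⟩, ?_⟩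
  rw [sum_insert, sum_pair (neg_sub_ne_right hxy).symm]
  · abel
  · simp [hxy, (neg_sub_ne_left hxy).symm]

theorem isSTS_affineLines : IsSTS (affineLines W) := by
  refine isSTS_iff.2 ⟨fun s hs => (mem_affineLines.1 hs).1, fun x y hxy =>
    ⟨_, ⟨insert_mem_affineLines hxy, by simp, by simp⟩, ?_⟩⟩
  rintro s ⟨hs, hx, hy⟩
  exact eq_insert_of_mem_affineLines hs hxy hx hy

theorem neg_sub_mem {s : Finset W} (hs : s ∈ affineLines W) {x y : W}
    (hx : x ∈ s) (hy : y ∈ s) : -x - y ∈ s := by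
  by_cases hxy : x = y
  · rwa [← hxy, neg_sub_self]
  · rw [eq_insert_of_mem_affineLines hs hxy hx hy]
    simp

/-- A line is a coset of its direction: `v + x - y` arises by applying the third-point operation
twice. Hence a line is determined by its direction and one of its points. -/
theorem image_add_differences {s : Finset W} (hs : s ∈ affineLines W) {v : W} (hv : v ∈ s) :
    (differences s).image (v + ·) = s := by
  ext w
  simp only [differences, mem_image, mem_image₂]
  constructor
  · rintro ⟨_, ⟨x, hx, y, hy, rfl⟩, rfl⟩
    have := neg_sub_mem hs (neg_sub_mem hs hv hx) hy
    convert this using 1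
    abel
  · intro hw
    exact ⟨w - v, ⟨w, hw, v, hv, rfl⟩, by abel⟩

theorem image_add_mem_affineLines {s : Finset W} (hs : s ∈ affineLines W) (v : W) :
    s.image (v + ·) ∈ affineLines W := by
  rw [mem_affineLines] at hs ⊢
  rw [card_image_of_injective _ (add_right_injective v),
    sum_image fun x _ y _ h => add_right_injective v h, sum_add_distrib, hs.2, sum_const, hs.1]
  refine ⟨rfl, ?_⟩
  rw [add_zero, succ_nsmul, two_nsmul]
  exact add_add_self_eq_zero v

/-- The parallel classes are the sets of lines with a common direction. -/
theorem isResolvable_affineLines : IsResolvable (affineLines W) := by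
  have : Nonempty W := ⟨0⟩
  refine IsResolution.isResolvable
    (cls := fun D : (affineLines W).image differences =>
      (affineLines W).filter fun s => differences s = D.1)
    ⟨fun s => ?_, ?_, ?_⟩ (isSTS_iff.1 isSTS_affineLines).1
  · constructor
    · intro hs
      exact ⟨⟨_, mem_image_of_mem _ hs⟩, mem_filter.2 ⟨hs, rfl⟩⟩
    · rintro ⟨D, hD⟩
      exact (mem_filter.1 hD).1
  · rintro ⟨D, hD⟩ v
    obtain ⟨s, hs, rfl⟩ := mem_image.1 hD
    obtain ⟨x, hx⟩ := card_pos.1 (by rw [(mem_affineLines.1 hs).1]; norm_num : 0 < s.card)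
    refine ⟨s.image (v - x + ·), ⟨mem_filter.2 ⟨image_add_mem_affineLines hs _,
      differences_image_add _ _⟩, mem_image.2 ⟨x, hx, by abel⟩⟩, ?_⟩
    rintro s' ⟨hs', hv⟩
    obtain ⟨hs', hd⟩ := mem_filter.1 hs'
    have hv' : v ∈ s.image (v - x + ·) := mem_image.2 ⟨x, hx, by abel⟩
    rw [← image_add_differences hs' hv, hd,
      ← image_add_differences (image_add_mem_affineLines hs _) hv', differences_image_add]
  · rintro D D' s hs hs'
    exact Subtype.ext ((mem_filter.1 hs).2.symm.trans (mem_filter.1 hs').2)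

variable {n : ℕ} {e : affineLines W → Fin 3 → W}

/-- Three elements of `W` sum to zero exactly when they are all equal or form a line. This turns the
geometric condition into a linear one. -/
theorem isOver_affineLines_iff (he : IsLabelling (affineLines W) e)
    {B : Finset (Finset (W × Fin n))} (hB : IsSTS B) :
    IsOver e B ↔ ∀ b ∈ B, ∑ x ∈ b, x.1 = 0 := by
  have hc := (isSTS_iff.1 hB).1
  constructor
  · intro h b hb
    obtain ⟨a, b', rfl⟩ | ⟨l, g, rfl⟩ := h b hb
    · rw [sum_congr rfl fun x hx => (mem_fiberBlock.1 hx).1.symm, sum_const, hc _ hb,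
        succ_nsmul, two_nsmul]
      exact add_add_self_eq_zero a
    · have hl : univ.image (e l) = l.1 := by
        ext a
        rw [(he l).2]
        simp
      have hs := (mem_affineLines.1 l.2).2
      rw [← hl, sum_image fun p _ q _ h => (he l).1 h] at hs
      rw [lineBlock, sum_image fun p _ q _ h => (he l).1 (congrArg Prod.fst h)]
      exact hs
  · intro h b hb
    obtain ⟨x, y, z, hxy, hxz, hyz, rfl⟩ := card_eq_three.1 (hc b hb)
    have hsum := h _ hb
    rw [sum_insert (by simp [hxy, hxz]), sum_pair hyz] at hsum
    have hz : z.1 = -x.1 - y.1 := by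
      rw [← add_assoc] at hsum
      rw [← neg_add', eq_neg_of_add_eq_zero_right hsum]
    by_cases h1 : x.1 = y.1
    · rw [← h1, neg_sub_self] at hz
      refine Or.inl ⟨x.1, {x.2, y.2, z.2}, ?_⟩
      have hx : x = (x.1, x.2) := rfl
      have hy : y = (x.1, y.2) := Prod.ext h1.symm rfl
      have hz' : z = (x.1, z.2) := Prod.ext hz rfl
      conv_lhs => rw [hx, hy, hz']
      simp [fiberBlock, image_insert]
    · have hmem : ({x.1, y.1, z.1} : Finset W) ∈ affineLines W := by
        rw [hz]
        exact insert_mem_affineLines h1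
      have hxz1 : x.1 ≠ z.1 := hz ▸ (neg_sub_ne_left h1).symm
      have hyz1 : y.1 ≠ z.1 := hz ▸ (neg_sub_ne_right h1).symm
      -- At each position `g` reads off the second coordinate of the block point above that point of
      -- the line.
      refine Or.inr ⟨⟨_, hmem⟩, fun p => if e ⟨_, hmem⟩ p = x.1 then x.2 else
        if e ⟨_, hmem⟩ p = y.1 then y.2 else z.2, eq_of_subset_of_card_le ?_ ?_⟩
      · intro w hw
        have hw1 : w.1 ∈ ({x.1, y.1, z.1} : Finset W) := by
          simp only [mem_insert, mem_singleton] at hw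
          obtain rfl | rfl | rfl := hw <;> simp
        obtain ⟨p, hp⟩ := ((he ⟨_, hmem⟩).2 w.1).1 hw1
        refine mem_lineBlock.2 ⟨p, hp, ?_⟩
        simp only [mem_insert, mem_singleton] at hw
        obtain rfl | rfl | rfl := hw
        · simp [hp]
        · simp [hp, Ne.symm h1]
        · simp [hp, hxz1.symm, hyz1.symm]
      · rw [card_lineBlock (he _).1, hc _ hb]

end Affine

/-! ### The dual code, the rank and the affine code -/

section Dual

variable {P : Type*}

/-- The functions over the field with three elements that sum to zero over every block. -/
def dualCode (B : Finset (Finset P)) : Submodule (ZMod 3) (P → ZMod 3) where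
  carrier := {f | ∀ b ∈ B, ∑ x ∈ b, f x = 0}
  add_mem' hf hg b hb := by simp [sum_add_distrib, hf b hb, hg b hb]
  zero_mem' b hb := by simp
  smul_mem' c f hf b hb := by simp [← mul_sum, hf b hb]

theorem mem_dualCode {B : Finset (Finset P)} {f : P → ZMod 3} :
    f ∈ dualCode B ↔ ∀ b ∈ B, ∑ x ∈ b, f x = 0 :=
  Iff.rfl

theorem threeRank_add_finrank_dualCode [DecidableEq P] [Fintype P] (B : Finset (Finset P)) :
    threeRank B + Module.finrank (ZMod 3) (dualCode B) = Fintype.card P := by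
  have : dualCode B = LinearMap.ker (incidenceMatrix B).mulVecLin := by
    ext f
    rw [mem_dualCode, LinearMap.mem_ker, funext_iff, Subtype.forall]
    refine forall₂_congr fun b hb => ?_
    simp [Matrix.mulVec, dotProduct, incidenceMatrix]
  rw [this, threeRank, Matrix.rank, LinearMap.finrank_range_add_finrank_ker,
    Module.finrank_fintype_fun_eq_card]

variable {Q : Type*} [DecidableEq Q]

theorem mem_dualCode_mapBlocks (e : P ≃ Q) {B : Finset (Finset P)} {f : Q → ZMod 3} :
    f ∈ dualCode (mapBlocks e B) ↔ f ∘ e ∈ dualCode B := by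
  simp only [mem_dualCode, mapBlocks, forall_mem_image]
  refine forall₂_congr fun b _ => ?_
  rw [sum_image fun x _ y _ h => e.injective h]
  rfl

theorem threeRank_mapBlocks [DecidableEq P] [Fintype P] [Fintype Q] (e : P ≃ Q)
    (B : Finset (Finset P)) : threeRank (mapBlocks e B) = threeRank B := by
  have h1 := threeRank_add_finrank_dualCode B
  have h2 := threeRank_add_finrank_dualCode (mapBlocks e B)
  have h3 : (dualCode (mapBlocks e B)).map
      (LinearEquiv.funCongrLeft (ZMod 3) (ZMod 3) e).toLinearMap = dualCode B := by
    ext f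
    rw [Submodule.mem_map]
    constructor
    · rintro ⟨g, hg, rfl⟩
      exact (mem_dualCode_mapBlocks e).1 hg
    · intro hf
      refine ⟨f ∘ e.symm, (mem_dualCode_mapBlocks e).2 ?_, ?_⟩
      · rwa [Function.comp_assoc, e.symm_comp_self, Function.comp_id]
      · ext x
        simp [LinearEquiv.funCongrLeft]
  have h4 := LinearEquiv.finrank_map_eq (LinearEquiv.funCongrLeft (ZMod 3) (ZMod 3) e)
    (dualCode (mapBlocks e B))
  rw [h3] at h4
  rw [← Fintype.card_congr e] at h2
  omega

variable (W : Type*) [AddCommGroup W] [Module (ZMod 3) W] (n : ℕ)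

/-- The map sending a linear form and a constant to the affine function on the fibred point set. -/
def affineCodeMap : Module.Dual (ZMod 3) W × ZMod 3 →ₗ[ZMod 3] (W × Fin n → ZMod 3) where
  toFun q x := q.1 x.1 + q.2
  map_add' q q' := by ext x; simp; ring
  map_smul' c q := by ext x; simp; ring

/-- The affine functions of the first coordinate. -/
def affineCode : Submodule (ZMod 3) (W × Fin n → ZMod 3) :=
  LinearMap.range (affineCodeMap W n)

variable {W n}

theorem mem_affineCode {f : W × Fin n → ZMod 3} :
    f ∈ affineCode W n ↔ ∃ (ξ : Module.Dual (ZMod 3) W) (c : ZMod 3), ∀ x, f x = ξ x.1 + c := by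
  simp only [affineCode, LinearMap.mem_range, Prod.exists, funext_iff, eq_comm (b := f _)]
  rfl

theorem finrank_affineCode [NeZero n] [Finite W] :
    Module.finrank (ZMod 3) (affineCode W n) = Module.finrank (ZMod 3) W + 1 := by
  have hinj : Function.Injective (affineCodeMap W n) := by
    rintro ⟨ξ, c⟩ ⟨ξ', c'⟩ h
    have h' : ∀ w, ξ w + c = ξ' w + c' := fun w => congrFun h (w, 0)
    have hc : c = c' := by simpa using h' 0
    subst hc
    exact Prod.ext (LinearMap.ext fun w => add_right_cancel (h' w)) rfl
  rw [affineCode, LinearMap.finrank_range_of_inj hinj, Module.finrank_prod,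
    Subspace.dual_finrank_eq, Module.finrank_self]

/-- Linear forms separate the points of `W`, and constants cost nothing because a block has three
points. -/
theorem affineCode_le_dualCode_iff [DecidableEq W] {B : Finset (Finset (W × Fin n))}
    (hB : IsSTS B) : affineCode W n ≤ dualCode B ↔ ∀ b ∈ B, ∑ x ∈ b, x.1 = 0 := by
  constructor
  · intro h b hb
    rw [← Module.forall_dual_apply_eq_zero_iff (ZMod 3)]
    intro ξ
    rw [map_sum]
    exact h (mem_affineCode.2 ⟨ξ, 0, fun x => (add_zero _).symm⟩) b hb
  · intro h f hf b hb
    obtain ⟨ξ, c, hf⟩ := mem_affineCode.1 hf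
    rw [sum_congr rfl fun x _ => hf x, sum_add_distrib, ← map_sum, h b hb, sum_const,
      (isSTS_iff.1 hB).1 b hb, succ_nsmul, two_nsmul, add_add_self_eq_zero, map_zero, add_zero]

/-- A function that sums to zero over every block has fibres of the same size, if it is onto. -/
theorem card_fiber_eq [DecidableEq P] [Fintype P] [DecidableEq W] {B : Finset (Finset P)}
    (hB : IsSTS B) {G : P → W} (hG : ∀ b ∈ B, ∑ x ∈ b, G x = 0) (hs : G.Surjective) (y z : W) :
    (univ.filter (G · = y)).card = (univ.filter (G · = z)).card := by
  have key : ∀ y z : W, y ≠ z →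
      (univ.filter (G · = y)).card ≤ (univ.filter (G · = z)).card := by
    intro y z hyz
    -- The value at `x₀` completes `y` and `z` to a line, so the block through `x₀` and a point over
    -- `y` has its third point over `z`. This assigns to each point over `y` a point over `z`.
    obtain ⟨x₀, hx₀⟩ := hs (-y - z)
    have h1 : ∀ x ∈ univ.filter (G · = y), ∃ x', G x' = z ∧ ∃ b ∈ B, x₀ ∈ b ∧ x ∈ b ∧ x' ∈ b := by
      intro x hx
      have hxy : G x = y := (mem_filter.1 hx).2
      have hne : x₀ ≠ x := by
        rintro rfl
        exact neg_sub_ne_left hyz (hx₀.symm.trans hxy)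
      obtain ⟨b, ⟨hb, hb₀, hbx⟩, -⟩ := (isSTS_iff.1 hB).2 x₀ x hne
      obtain ⟨x', h₀', hx', rfl⟩ :=
        exists_eq_insert_of_card_eq_three ((isSTS_iff.1 hB).1 b hb) hb₀ hbx hne
      refine ⟨x', ?_, _, hb, hb₀, hbx, by simp⟩
      have h := hG _ hb
      rw [sum_insert (by simp [hne, h₀']), sum_pair hx', hx₀, hxy] at h
      have : G x' - z = 0 := by rw [← h]; abel
      exact sub_eq_zero.1 this
    choose! F hFz b hb hb₀ hbx hbF using h1
    refine card_le_card_of_injOn F (fun x hx => ?_) fun x hx x' hx' hF => ?_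
    · exact mem_filter.2 ⟨mem_univ _, hFz x hx⟩
    · rw [mem_coe] at hx hx'
      have hne : x₀ ≠ F x := by
        intro h
        have := hFz x hx
        rw [← h, hx₀] at this
        exact neg_sub_ne_right hyz this
      have hbb : b x = b x' := hB.eq_of_mem hne (hb x hx) (hb x' hx') (hb₀ x hx) (hbF x hx)
        (hb₀ x' hx') (hF ▸ hbF x' hx')
      by_contra hxx
      have hxy : G x = y := (mem_filter.1 hx).2
      have hxy' : G x' = y := (mem_filter.1 hx').2
      obtain ⟨w, hxw, hxw', hbw⟩ := exists_eq_insert_of_card_eq_three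
        ((isSTS_iff.1 hB).1 _ (hb x hx)) (hbx x hx) (hbb ▸ hbx x' hx') hxx
      -- Two points of this block lie over `y`, leaving room for only one other point; but `x₀` and
      -- `F x` are distinct and neither lies over `y`.
      have hw : ∀ u ∈ b x, G u ≠ y → u = w := by
        intro u hu huy
        rw [hbw] at hu
        simp only [mem_insert, mem_singleton] at hu
        obtain rfl | rfl | rfl := hu
        exacts [absurd hxy huy, absurd hxy' huy, rfl]
      refine hne ((hw _ (hb₀ x hx) ?_).trans (hw _ (hbF x hx) ?_).symm)
      · rw [hx₀]
        exact neg_sub_ne_left hyz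
      · rw [hFz x hx]
        exact hyz.symm
  by_cases hyz : y = z
  · rw [hyz]
  · exact le_antisymm (key y z hyz) (key z y (Ne.symm hyz))

/-- The image of a function summing to zero over every block is closed under the line
operation. -/
theorem exists_eq_neg_sub [DecidableEq P] {B : Finset (Finset P)} (hB : IsSTS B)
    {G : P → W} (hG : ∀ b ∈ B, ∑ x ∈ b, G x = 0) (x y : P) : ∃ z, G z = -G x - G y := by
  by_cases hxy : x = y
  · exact ⟨x, by rw [← hxy, neg_sub_self]⟩
  · obtain ⟨b, ⟨hb, hbx, hby⟩, -⟩ := (isSTS_iff.1 hB).2 x y hxy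
    obtain ⟨z, hxz, hyz, rfl⟩ :=
      exists_eq_insert_of_card_eq_three ((isSTS_iff.1 hB).1 b hb) hbx hby hxy
    have h := hG _ hb
    rw [sum_insert (by simp [hxy, hxz]), sum_pair hyz, ← add_assoc] at h
    exact ⟨z, by rw [← neg_add', eq_neg_of_add_eq_zero_right h]⟩

/-- The image is closed under the third-point operation, so its differences from a base value form a
subspace. If it were proper, a nonzero linear form `ψ` would vanish on it; solving that equation for
`f` would make `f` an affine function of the first coordinate. -/
theorem surjective_prodMk_of_notMem_affineCode [NeZero n] [DecidableEq W]
    {B : Finset (Finset (W × Fin n))} (hB : IsSTS B) (hA : affineCode W n ≤ dualCode B)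
    {f : W × Fin n → ZMod 3} (hf : f ∈ dualCode B) (hfA : f ∉ affineCode W n) :
    Function.Surjective fun x : W × Fin n => (x.1, f x) := by
  set G : W × Fin n → W × ZMod 3 := fun x => (x.1, f x) with hGdef
  have hG : ∀ b ∈ B, ∑ x ∈ b, G x = 0 := by
    intro b hb
    refine Prod.ext ?_ ?_
    · rw [Prod.fst_sum]
      exact (affineCode_le_dualCode_iff hB).1 hA b hb
    · rw [Prod.snd_sum]
      exact hf b hb
  have hcl := exists_eq_neg_sub hB hG
  let o : W × Fin n := (0, 0)
  have hneg : ∀ x, ∃ z, G z - G o = -(G x - G o) := by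
    intro x
    obtain ⟨z, hz⟩ := hcl x o
    refine ⟨z, ?_⟩
    rw [hz, ← sub_eq_zero, ← neg_eq_zero]
    rw [← add_add_self_eq_zero (G o)]
    abel
  have hadd : ∀ x y, ∃ z, G z - G o = (G x - G o) + (G y - G o) := by
    intro x y
    obtain ⟨w, hw⟩ := hcl x y
    obtain ⟨z, hz⟩ := hcl w o
    refine ⟨z, ?_⟩
    rw [hz, hw]
    abel
  let N : AddSubgroup (W × ZMod 3) :=
    { carrier := Set.range fun x => G x - G o
      zero_mem' := ⟨o, sub_self _⟩
      add_mem' := by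
        rintro _ _ ⟨x, rfl⟩ ⟨y, rfl⟩
        exact hadd x y
      neg_mem' := by
        rintro _ ⟨x, rfl⟩
        exact hneg x }
  by_cases htop : AddSubgroup.toZModSubmodule 3 N = ⊤
  · intro y
    have : y - G o ∈ AddSubgroup.toZModSubmodule 3 N := by
      rw [htop]
      trivial
    obtain ⟨x, hx⟩ := this
    exact ⟨x, sub_left_injective hx⟩
  · exfalso
    obtain ⟨ψ, hψ, hle⟩ := Submodule.exists_le_ker_of_lt_top _ (lt_top_iff_ne_top.2 htop)
    have hψG : ∀ x, ψ (x.1, f x - f o) = 0 := by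
      intro x
      have : G x - G o ∈ AddSubgroup.toZModSubmodule 3 N := ⟨x, rfl⟩
      have h := hle this
      rw [LinearMap.mem_ker] at h
      rwa [hGdef, Prod.mk_sub_mk, sub_zero] at h
    have hsplit : ∀ w c, ψ (w, c) = ψ (w, 0) + c * ψ (0, 1) := by
      intro w c
      rw [← smul_eq_mul, ← map_smul, ← map_add]
      simp
    -- If this coefficient vanishes, `ψ` depends only on the first coordinate, which takes every
    -- value, so `ψ = 0`. Otherwise one can divide by it.
    by_cases h1 : ψ (0, 1) = 0
    · refine hψ (LinearMap.ext fun q => ?_)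
      have h := hψG (q.1, 0)
      rw [hsplit, h1, mul_zero, add_zero] at h
      rw [← Prod.mk.eta (p := q), hsplit, h1, mul_zero, add_zero]
      exact h
    · refine hfA (mem_affineCode.2 ⟨-(ψ (0, 1))⁻¹ • ψ ∘ₗ LinearMap.inl (ZMod 3) W (ZMod 3),
        f o, fun x => ?_⟩)
      have h := hψG x
      rw [hsplit] at h
      have h2 : ψ (x.1, 0) = -((f x - f o) * ψ (0, 1)) := eq_neg_of_add_eq_zero_left h
      simp only [LinearMap.smul_apply, LinearMap.comp_apply, LinearMap.inl_apply, smul_eq_mul, h2]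
      field_simp
      ring

end Dual

theorem exists_equiv_prod_of_card_fiber {P Q : Type*} [Fintype P] [DecidableEq Q] {m : ℕ}
    {G : P → Q} (hG : ∀ y, (univ.filter (G · = y)).card = m) :
    ∃ ψ : P ≃ Q × Fin m, ∀ x, (ψ x).1 = G x := by
  have hc : ∀ y, Fintype.card {x // G x = y} = m := fun y => by
    rw [Fintype.card_subtype, hG]
  refine ⟨((Equiv.sigmaFiberEquiv G).symm.trans
    (Equiv.sigmaCongrRight fun y => Fintype.equivFinOfCardEq (hc y))).trans
      (Equiv.sigmaEquivProd Q (Fin m)), fun x => rfl⟩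

theorem card_le_card_mul_of_card_fiber_le {X Y : Type*} [Finite X] [Finite Y] (f : X → Y) (K : ℕ)
    (h : ∀ x₀, Nat.card {x // f x = f x₀} ≤ K) : Nat.card X ≤ Nat.card Y * K := by
  classical
  have := Fintype.ofFinite X
  have := Fintype.ofFinite Y
  rw [Nat.card_eq_fintype_card, Nat.card_eq_fintype_card, mul_comm, ← card_univ, ← card_univ]
  refine card_le_mul_card_image_of_maps_to (f := f) (fun x _ => mem_univ _) K fun y _ => ?_
  by_cases hy : ∃ x₀, f x₀ = y
  · obtain ⟨x₀, rfl⟩ := hy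
    rw [← Fintype.card_subtype, ← Nat.card_eq_fintype_card]
    exact h x₀
  · rw [filter_eq_empty_iff.2 fun x _ hx => hy ⟨x, hx⟩]
    exact Nat.zero_le _

/-! ### Fibred permutations and isomorphism classes -/

section Automorphisms

variable {d n : ℕ}

instance : Finite (AGL3 d) :=
  Finite.of_injective (fun A : AGL3 d => (A : (Fin d → ZMod 3) → Fin d → ZMod 3))
    DFunLike.coe_injective

/-- The permutations of the points that induce an affine bijection of the base. -/
abbrev FiberedPerm (d n : ℕ) : Type :=
  {e : Equiv.Perm ((Fin d → ZMod 3) × Fin n) // ∃ A : AGL3 d, ∀ x, (e x).1 = A x.1}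

theorem card_fiberedPerm_le :
    Nat.card (FiberedPerm d n) ≤ n ! ^ 3 ^ d * Nat.card (AGL3 d) := by
  choose A hA using fun e : FiberedPerm d n => e.2
  have hinj : ∀ (e : FiberedPerm d n) (a : Fin d → ZMod 3),
      Function.Injective fun i => (e.1 (a, i)).2 := by
    intro e a i j hij
    have : (a, i) = (a, j) := e.1.injective (Prod.ext (by rw [hA, hA]) hij)
    exact congrArg Prod.snd this
  let F : FiberedPerm d n → ((Fin d → ZMod 3) → Equiv.Perm (Fin n)) × AGL3 d := fun e =>
    (fun a => Equiv.ofBijective _ (Finite.injective_iff_bijective.1 (hinj e a)), A e)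
  have hF : Function.Injective F := by
    intro e e' h
    have h2 : A e = A e' := congrArg Prod.snd h
    refine Subtype.ext (Equiv.ext fun x => Prod.ext ?_ ?_)
    · rw [hA, hA, h2]
    · exact congrArg (fun σ : Equiv.Perm (Fin n) => σ x.2) (congrFun (congrArg Prod.fst h) x.1)
  refine (Nat.card_le_card_of_injective F hF).trans_eq ?_
  rw [Nat.card_prod, Nat.card_fun, Nat.card_perm, Nat.card_fin, Nat.card_fun, Nat.card_zmod,
    Nat.card_fin]

/-- The base coordinates lie in the dual code of the image system, so their pullbacks along `e` lie
in that of `B`. Both codes being affine, each base coordinate of `e x` is an affine function of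
`x.1`. -/
theorem exists_affine_of_dualCode_eq [NeZero n]
    {B : Finset (Finset ((Fin d → ZMod 3) × Fin n))} (e : Equiv.Perm ((Fin d → ZMod 3) × Fin n))
    (hB : dualCode B = affineCode (Fin d → ZMod 3) n)
    (hB' : dualCode (mapBlocks e B) = affineCode (Fin d → ZMod 3) n) :
    ∃ A : AGL3 d, ∀ x, (e x).1 = A x.1 := by
  have hcoord : ∀ i : Fin d, ∃ (ξ : Module.Dual (ZMod 3) (Fin d → ZMod 3)) (c : ZMod 3),
      ∀ x, (e x).1 i = ξ x.1 + c := by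
    intro i
    have h : (fun x : (Fin d → ZMod 3) × Fin n => x.1 i) ∈ dualCode (mapBlocks e B) := by
      rw [hB']
      exact mem_affineCode.2 ⟨LinearMap.proj i, 0, fun x => by simp⟩
    rw [mem_dualCode_mapBlocks, hB] at h
    exact mem_affineCode.1 h
  choose ξ c hξ using hcoord
  let A : (Fin d → ZMod 3) →ᵃ[ZMod 3] (Fin d → ZMod 3) :=
    (LinearMap.pi ξ).toAffineMap + AffineMap.const (ZMod 3) (Fin d → ZMod 3) c
  have hA : ∀ x, (e x).1 = A x.1 := fun x => funext fun i => hξ i x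
  have hs : Function.Surjective A := fun w =>
    ⟨(e.symm (w, 0)).1, by rw [← hA, Equiv.apply_symm_apply]⟩
  exact ⟨AffineEquiv.ofBijective (Finite.surjective_iff_bijective.1 hs), hA⟩

/-- Each isomorphism class contains a bounded number of systems with the dual code
`affineCode`. -/
theorem card_dualCode_eq_le [NeZero n] {v r : ℕ} (hv : 3 ^ d * n = v) (hr : r + (d + 1) = v) :
    Nat.card {B : Finset (Finset ((Fin d → ZMod 3) × Fin n)) //
        (IsSTS B ∧ IsResolvable B) ∧ dualCode B = affineCode (Fin d → ZMod 3) n} ≤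
      numIsoClasses v r * (n ! ^ 3 ^ d * Nat.card (AGL3 d)) := by
  have hcard : Fintype.card ((Fin d → ZMod 3) × Fin n) = v := by
    simp [ZMod.card, hv]
  let τ : (Fin d → ZMod 3) × Fin n ≃ Fin v := Fintype.equivFinOfCardEq hcard
  have hrank : ∀ B : Finset (Finset ((Fin d → ZMod 3) × Fin n)),
      dualCode B = affineCode (Fin d → ZMod 3) n → threeRank (mapBlocks τ B) = r := by
    intro B hB
    have h := threeRank_add_finrank_dualCode B
    rw [hB, finrank_affineCode, hcard, Module.finrank_fin_fun] at h
    rw [threeRank_mapBlocks]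
    omega
  have : Finite (ResolvableSTS v r) := by
    unfold ResolvableSTS
    infer_instance
  have : Finite (Quotient (resolvableSTSSetoid v r)) := Quotient.finite _
  have hmap : ∀ B : Finset (Finset ((Fin d → ZMod 3) × Fin n)),
      (IsSTS B ∧ IsResolvable B) ∧ dualCode B = affineCode (Fin d → ZMod 3) n →
        IsSTS (mapBlocks τ B) ∧ IsResolvable (mapBlocks τ B) ∧ threeRank (mapBlocks τ B) = r := by
    rintro B ⟨⟨hS, hR⟩, hD⟩
    exact ⟨hS.mapBlocks τ, hR.mapBlocks τ hS, hrank B hD⟩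
  let cl : {B : Finset (Finset ((Fin d → ZMod 3) × Fin n)) //
      (IsSTS B ∧ IsResolvable B) ∧ dualCode B = affineCode (Fin d → ZMod 3) n} →
      Quotient (resolvableSTSSetoid v r) := fun B => Quotient.mk _ ⟨_, hmap B.1 B.2⟩
  refine (card_le_card_mul_of_card_fiber_le cl (Nat.card (FiberedPerm d n)) fun B₀ => ?_).trans
    (Nat.mul_le_mul_left _ card_fiberedPerm_le)
  -- Every system in the class of `B₀` is its image under a fibred permutation, and that permutation
  -- determines the system.
  have hex : ∀ B : {B // cl B = cl B₀}, ∃ e : FiberedPerm d n, mapBlocks e.1 B₀.1 = B.1.1 := by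
    rintro ⟨B, hB⟩
    obtain ⟨f, hf⟩ : Isomorphic (mapBlocks τ B₀.1) (mapBlocks τ B.1) :=
      Quotient.exact (s := resolvableSTSSetoid v r) hB.symm
    have he : mapBlocks ((τ.trans f).trans τ.symm) B₀.1 = B.1 := by
      refine mapBlocks_injective τ ?_
      rw [← hf]
      simp [mapBlocks, image_image, Function.comp_def]
    exact ⟨⟨_, exists_affine_of_dualCode_eq _ B₀.2.2 (he ▸ B.2.2)⟩, he⟩
  choose E hE using hex
  refine Nat.card_le_card_of_injective E fun B B' h => Subtype.ext (Subtype.ext ?_)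
  rw [← hE B, ← hE B', h]

end Automorphisms

/-! ### Systems with a larger dual code -/

section Balanced

variable {n m : ℕ}

/-- The ternary functions on `Fin n` taking every value `m` times. -/
abbrev Balanced (n m : ℕ) : Type :=
  {f : Fin n → ZMod 3 // ∀ c, (univ.filter (f · = c)).card = m}

/-- Refining a balanced function by an ordering of each of its three level sets gives distinct
bijections onto `ZMod 3 × Fin m`, of which there are `n!`. -/
theorem card_balanced_mul_le (h : n = 3 * m) : Nat.card (Balanced n m) * m ! ^ 3 ≤ n ! := by
  choose ψ hψ using fun f : Balanced n m => exists_equiv_prod_of_card_fiber f.2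
  let F : Balanced n m × (ZMod 3 → Equiv.Perm (Fin m)) → (Fin n ≃ ZMod 3 × Fin m) := fun q =>
    (ψ q.1).trans (Equiv.prodShear (Equiv.refl _) q.2)
  have hF : Function.Injective F := by
    rintro ⟨f, σ⟩ ⟨f', σ'⟩ heq
    have h1 : f = f' := by
      refine Subtype.ext (funext fun i => ?_)
      rw [← hψ f, ← hψ f']
      exact congrArg (fun q => (q i).1) heq
    subst h1
    refine Prod.ext rfl (funext fun c => Equiv.ext fun j => ?_)
    have := congrArg (fun q => (q ((ψ f).symm (c, j))).2) heq
    simpa [F] using this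
  have hc := Nat.card_le_card_of_injective F hF
  have e : Fin n ≃ ZMod 3 × Fin m := Fintype.equivOfCardEq (by simp [ZMod.card, h])
  rw [Nat.card_prod, Nat.card_fun, Nat.card_perm, Nat.card_zmod, Nat.card_fin,
    Nat.card_eq_fintype_card (α := Fin n ≃ ZMod 3 × Fin m), Fintype.card_equiv e,
    Fintype.card_fin] at hc
  exact hc

end Balanced

section Larger

variable {W : Type*} [AddCommGroup W] [Module (ZMod 3) W] [Fintype W] [DecidableEq W] {n m : ℕ}

theorem card_filter_eq_of_mem_dualCode [NeZero n] (h : n = 3 * m)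
    {B : Finset (Finset (W × Fin n))} (hB : IsSTS B) (hA : affineCode W n ≤ dualCode B)
    {f : W × Fin n → ZMod 3} (hf : f ∈ dualCode B) (hfA : f ∉ affineCode W n) (y : W × ZMod 3) :
    (univ.filter fun x : W × Fin n => (x.1, f x) = y).card = m := by
  have hG : ∀ b ∈ B, ∑ x ∈ b, ((x.1, f x) : W × ZMod 3) = 0 := by
    intro b hb
    refine Prod.ext ?_ ?_
    · rw [Prod.fst_sum]
      exact (affineCode_le_dualCode_iff hB).1 hA b hb
    · rw [Prod.snd_sum]
      exact hf b hb
  have heq := card_fiber_eq hB hG (surjective_prodMk_of_notMem_affineCode hB hA hf hfA)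
  have hsum := card_eq_sum_card_fiberwise (f := fun x : W × Fin n => ((x.1, f x) : W × ZMod 3))
    (s := univ) (t := univ) fun x _ => mem_univ _
  rw [sum_congr rfl fun z _ => heq z y, sum_const, card_univ, card_univ, Fintype.card_prod,
    Fintype.card_prod, ZMod.card, Fintype.card_fin, smul_eq_mul, mul_assoc] at hsum
  have hpos : 0 < Fintype.card W := Fintype.card_pos_iff.2 ⟨0⟩
  have := Nat.eq_of_mul_eq_mul_left hpos hsum
  omega

/-- The number of systems over `W` whose dual code is larger than `affineCode`. -/
theorem card_lt_dualCode_le [NeZero n] (h : n = 3 * m) :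
    Nat.card {B : Finset (Finset (W × Fin n)) // IsSTS B ∧ affineCode W n < dualCode B} ≤
      Nat.card (Balanced n m) ^ Fintype.card W *
        (numSTS m ^ Fintype.card (W × ZMod 3) *
          numLatin m ^ (affineLines (W × ZMod 3)).card) := by
  obtain ⟨e, he⟩ := (isSTS_affineLines (W := W × ZMod 3)).exists_isLabelling
  choose f hf hfA using fun B : {B : Finset (Finset (W × Fin n)) //
    IsSTS B ∧ affineCode W n < dualCode B} => SetLike.exists_of_lt B.2.2
  have hcard := fun B => card_filter_eq_of_mem_dualCode h B.2.1 B.2.2.le (hf B) (hfA B)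
  -- The relabelling must depend on the function alone, not on the system, so that the function and
  -- the relabelled system together recover the original. Functions without equal fibres get an
  -- arbitrary bijection that is never relied on.
  have hψ : ∀ g : W × Fin n → ZMod 3, ∃ ψ : W × Fin n ≃ (W × ZMod 3) × Fin m,
      (∀ y : W × ZMod 3, (univ.filter fun x : W × Fin n => (x.1, g x) = y).card = m) →
        ∀ x, (ψ x).1 = (x.1, g x) := by
    intro g
    by_cases hg : ∀ y : W × ZMod 3, (univ.filter fun x : W × Fin n => (x.1, g x) = y).card = m
    · obtain ⟨ψ, hψ⟩ := exists_equiv_prod_of_card_fiber hg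
      exact ⟨ψ, fun _ => hψ⟩
    · exact ⟨Fintype.equivOfCardEq (by simp [ZMod.card, h, mul_assoc]), fun hg' => absurd hg' hg⟩
  choose ψ hψ using hψ
  have hbal : ∀ B a c, (univ.filter (fun i => f B (a, i) = c)).card = m := by
    intro B a c
    rw [← hcard B (a, c)]
    refine card_bij (fun i _ => (a, i)) (fun i hi => ?_) (fun i _ j _ hij => ?_) fun x hx => ?_
    · simpa using hi
    · exact congrArg Prod.snd hij
    · obtain ⟨b, i⟩ := x
      simp only [mem_filter, mem_univ, true_and, Prod.mk.injEq] at hx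
      obtain ⟨rfl, hx⟩ := hx
      exact ⟨i, by simpa using hx, rfl⟩
  have hover : ∀ B, IsOver e (mapBlocks (ψ (f B)) B.1) := by
    intro B
    rw [isOver_affineLines_iff he (B.2.1.mapBlocks _)]
    simp only [mapBlocks, forall_mem_image]
    intro b hb
    rw [sum_image fun x _ y _ hxy => (ψ (f B)).injective hxy,
      sum_congr rfl fun x _ => hψ (f B) (hcard B) x]
    refine Prod.ext ?_ ?_
    · rw [Prod.fst_sum]
      exact (affineCode_le_dualCode_iff B.2.1).1 B.2.2.le b hb
    · rw [Prod.snd_sum]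
      exact hf B b hb
  let F : {B : Finset (Finset (W × Fin n)) // IsSTS B ∧ affineCode W n < dualCode B} →
      (W → Balanced n m) ×
        {B : Finset (Finset ((W × ZMod 3) × Fin m)) // IsSTS B ∧ IsOver e B} := fun B =>
    (fun a => ⟨fun i => f B (a, i), hbal B a⟩,
      ⟨mapBlocks (ψ (f B)) B.1, B.2.1.mapBlocks _, hover B⟩)
  have hF : Function.Injective F := by
    intro B B' hBB
    have h1 : f B = f B' := by
      funext x
      exact congrFun (congrArg Subtype.val (congrFun (congrArg Prod.fst hBB) x.1)) x.2
    have h2 : mapBlocks (ψ (f B)) B.1 = mapBlocks (ψ (f B')) B'.1 :=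
      congrArg Subtype.val (congrArg Prod.snd hBB)
    rw [h1] at h2
    exact Subtype.ext (mapBlocks_injective _ h2)
  refine (Nat.card_le_card_of_injective F hF).trans ?_
  rw [Nat.card_prod, Nat.card_fun, Nat.card_eq_fintype_card (α := W)]
  exact Nat.mul_le_mul_left _ (card_isOver_le isSTS_affineLines he)

/-- The systems over `W` have dual code `affineCode` or a larger one. -/
theorem le_card_dualCode_eq_add [NeZero n] :
    numResolvableSTS n ^ Fintype.card W * numLatinWithMate n ^ (affineLines W).card ≤
      Nat.card {B : Finset (Finset (W × Fin n)) //
        (IsSTS B ∧ IsResolvable B) ∧ dualCode B = affineCode W n} +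
      Nat.card {B : Finset (Finset (W × Fin n)) // IsSTS B ∧ affineCode W n < dualCode B} := by
  obtain ⟨e, he⟩ := (isSTS_affineLines (W := W)).exists_isLabelling
  have : Nonempty W := ⟨0⟩
  refine (le_card_isOver isSTS_affineLines isResolvable_affineLines he).trans ?_
  -- Resolvability is dropped from the systems with larger dual code, since these only need an upper
  -- bound.
  refine (Set.ncard_le_ncard (s := {B : Finset (Finset (W × Fin n)) |
    (IsSTS B ∧ IsResolvable B) ∧ IsOver e B}) (t := {B : Finset (Finset (W × Fin n)) |
    (IsSTS B ∧ IsResolvable B) ∧ dualCode B = affineCode W n} ∪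
      {B : Finset (Finset (W × Fin n)) | IsSTS B ∧ affineCode W n < dualCode B}) ?_
      (Set.toFinite _)).trans (Set.ncard_union_le _ _)
  rintro B ⟨hB, ho⟩
  have hle := (affineCode_le_dualCode_iff hB.1).2 ((isOver_affineLines_iff he hB.1).1 ho)
  rcases eq_or_lt_of_le hle with heq | hlt
  exacts [Or.inl ⟨hB, heq.symm⟩, Or.inr ⟨hB.1, hlt⟩]

end Larger

theorem card_affineLines {W : Type*} [AddCommGroup W] [Module (ZMod 3) W] [Fintype W]
    [DecidableEq W] :
    (affineLines W).card = Fintype.card W * (Fintype.card W - 1) / 6 := by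
  have := (isSTS_affineLines (W := W)).six_mul_card
  omega

end STSRank

/-! ### Assembling the bound -/

theorem corollary3p8 (k t T T' M M' : ℕ) (ht : 2 ≤ t) (htk : t ≤ k - 1)
    (hT : T = 3 ^ t) (hT' : T' = 3 ^ (t - 1))
    (hM : M = 3 ^ (k - t)) (hM' : M' = 3 ^ (k - t + 1)) :
    (STSRank.numResolvableSTS T : ℝ) ^ M *
          (STSRank.numLatinWithMate T : ℝ) ^ (M * (M - 1) / 6) /
        ((T ! : ℝ) ^ M * (Nat.card (STSRank.AGL3 (k - t)) : ℝ)) -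
      (STSRank.numSTS T' : ℝ) ^ M' * (STSRank.numLatin T' : ℝ) ^ (M' * (M' - 1) / 6) /
        (T' ! : ℝ) ^ ((M' : ℤ) - (k : ℤ) + (t : ℤ) - 2) ≤
    (STSRank.numIsoClasses (3 ^ k) (3 ^ k - k - 1 + t) : ℝ) := by
  have hTT : T = 3 * T' := by
    rw [hT, hT', ← pow_succ', Nat.sub_add_cancel (by omega)]
  have hMM : M' = M * 3 := by rw [hM, hM', pow_succ]
  have : NeZero T := ⟨by rw [hT]; positivity⟩
  have hv : 3 ^ (k - t) * T = 3 ^ k := by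
    rw [hT, ← pow_add, Nat.sub_add_cancel (by omega)]
  -- The rank and the dimension of the affine code are complementary; `k < 3 ^ k` keeps the natural
  -- subtraction from truncating.
  have hr : 3 ^ k - k - 1 + t + (k - t + 1) = 3 ^ k := by
    have : k < 3 ^ k := Nat.lt_pow_self (by norm_num)
    omega
  have hcW : Fintype.card (Fin (k - t) → ZMod 3) = M := by simp [ZMod.card, hM]
  have hcW' : Fintype.card ((Fin (k - t) → ZMod 3) × ZMod 3) = M' := by
    rw [Fintype.card_prod, hcW, ZMod.card, hMM]
  have h1 := STSRank.le_card_dualCode_eq_add (W := Fin (k - t) → ZMod 3) (n := T)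
  have h2 := STSRank.card_dualCode_eq_le (d := k - t) (n := T) hv hr
  have h3 := STSRank.card_lt_dualCode_le (W := Fin (k - t) → ZMod 3) hTT
  have h4 := Nat.pow_le_pow_left (STSRank.card_balanced_mul_le hTT) M
  rw [mul_pow, ← pow_mul, mul_comm 3, ← hMM] at h4
  rw [STSRank.card_affineLines, hcW] at h1
  rw [STSRank.card_affineLines, hcW, hcW'] at h3
  rw [← hM] at h2
  have hAGL : 1 ≤ Nat.card (STSRank.AGL3 (k - t)) := Nat.card_pos
  set a := STSRank.numResolvableSTS T ^ M * STSRank.numLatinWithMate T ^ (M * (M - 1) / 6) with ha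
  set N := STSRank.numSTS T' ^ M' * STSRank.numLatin T' ^ (M' * (M' - 1) / 6) with hN
  set G := Nat.card (STSRank.AGL3 (k - t)) with hG
  set I := STSRank.numIsoClasses (3 ^ k) (3 ^ k - k - 1 + t) with hI
  set b := Nat.card (STSRank.Balanced T T') ^ M with hb
  have h5 : a ≤ I * (T ! ^ M * G) + b * N := h1.trans (add_le_add h2 h3)
  have haR : (STSRank.numResolvableSTS T : ℝ) ^ M * (STSRank.numLatinWithMate T : ℝ) ^ (M * (M - 1) / 6) = a := by
    rw [ha]; push_cast; rfl
  have hNR : (STSRank.numSTS T' : ℝ) ^ M' * (STSRank.numLatin T' : ℝ) ^ (M' * (M' - 1) / 6) = N := by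
    rw [hN]; push_cast; rfl
  rw [haR, hNR]
  have h5R : (a : ℝ) ≤ I * ((T ! : ℝ) ^ M * G) + b * N := by exact_mod_cast h5
  have h4R : (b : ℝ) * (T' ! : ℝ) ^ M' ≤ (T ! : ℝ) ^ M := by exact_mod_cast h4
  have hGR : (1 : ℝ) ≤ G := by exact_mod_cast hAGL
  have hTpos : (0 : ℝ) < (T ! : ℝ) ^ M := by positivity
  have hT1 : (1 : ℝ) ≤ (T' ! : ℝ) := by exact_mod_cast Nat.factorial_pos T'
  -- The counting gives the full exponent `M'` and a further factor `|AGL|` in the denominator of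
  -- the subtracted term. The stated exponent is smaller, so both gains are given away here and in
  -- `hbz`.
  have hz : (T' ! : ℝ) ^ ((M' : ℤ) - (k : ℤ) + (t : ℤ) - 2) ≤ (T' ! : ℝ) ^ M' := by
    rw [← zpow_natCast]
    exact zpow_le_zpow_right₀ hT1 (by omega)
  have hzpos : (0 : ℝ) < (T' ! : ℝ) ^ ((M' : ℤ) - (k : ℤ) + (t : ℤ) - 2) := by positivity
  have hbz : (b : ℝ) * (T' ! : ℝ) ^ ((M' : ℤ) - (k : ℤ) + (t : ℤ) - 2) ≤ (T ! : ℝ) ^ M * G :=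
    ((mul_le_mul_of_nonneg_left hz (Nat.cast_nonneg _)).trans h4R).trans
      (le_mul_of_one_le_right hTpos.le hGR)
  have hK : (0 : ℝ) < (T ! : ℝ) ^ M * G := by positivity
  generalize (T' ! : ℝ) ^ ((M' : ℤ) - (k : ℤ) + (t : ℤ) - 2) = z at hbz hzpos
  generalize (T ! : ℝ) ^ M * (G : ℝ) = K at *
  rw [sub_le_iff_le_add, div_le_iff₀ hK]
  refine h5R.trans ?_
  rw [add_mul]
  refine add_le_add le_rfl ?_
  rw [div_mul_eq_mul_div, le_div_iff₀ hzpos]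
  calc (b : ℝ) * N * z = N * (b * z) := by ring
    _ ≤ N * K := by gcongr
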